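/- \textbf{Conventions.} $\mathbb N=\{1,2,\dots\}$, $\mathcal S=\mathcal S(\mathbb R;\mathbb C)$ is the Schwartz space, $\widehat\varphi(\omega)=\int_{\mathbb R}\varphi(x)e^{-i\omega x}\,dx$ and $(\mathcal F^{-1}f)(x)=\frac1{2\pi}\int_{\mathbb R}f(\omega)e^{i\omega x}\,d\omega$. For $a,b\in\mathbb C\setminus\{0\}$ and $\gamma\in\mathbb C$ put $h_{a,b}^{\gamma}(\omega)=a|\omega|^{\gamma}$ for $\omega>0$, $h_{a,b}^{\gamma}(\omega)=b|\omega|^{\gamma}$ for $\omega<0$, and $h_{a,b}^\gamma(0)=0$. For $k\in\mathbb N$ and $\varphi\in\mathcal S$ put $$\Phi(\omega)=\frac{\widehat\varphi(\omega)-\sum_{j=0}^{k-1}\frac{\widehat\varphi^{(j)}(0)}{j!}\omega^j}{h_{a,b}^{\gamma}(-\omega)},\qquad \mathrm I_{a,b}^{(\gamma;k)*}\varphi=\mathcal F^{-1}\{\Phi\},$$ the inverse Fourier transform being that of tempered distributions: $\langle \mathcal F^{-1}\{\Phi\},\psi\rangle=\int_{\mathbb R}\Phi(\omega)\,(\mathcal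 F^{-1}\psi)(\omega)\,d\omega$ for $\psi\in\mathcal S$. "Around $x=0$" means on some punctured neighbourhood of $0$, and $L_p$ with $0<p<\infty$ denotes the measurable $f$ with $\int|f|^p<\infty$. \textbf{Theorem.} Let $a,b\in\mathbb C\setminus\{0\}$, $\gamma\in\mathbb C$ with $\mathrm{Re}\,\gamma>0$, and let $k$ be an integer with $k\ge\max(1,\lfloor\mathrm{Re}\,\gamma\rfloor)$. Let $\varphi\in\mathcal S$. Then the integrals defining $\mathrm I_{a,b}^{(\gamma;k)*}\varphi$ converge absolutely and define a tempered distribution, and this distribution is a continuous function away from $0$: there is $g:\mathbb R\to\mathbb C$, continuous on $\mathbb R\setminus\{0\}$, such that $\langle \mathrm I_{a,b}^{(\gamma;k)*}\varphi,\psi\rangle=\int g\psi$ (an absolutely convergent integral) for every $\psi\in\mathcal S$ with $0\notin\mathrm{supp}\,\psi$, and even for every $\psi\in\mathcal S$ if $k-\mathrm{Re}\,\gamma<1$. Write $(\mathrm I_{a,b}^{(\gamma;k)*}\varphi)(x)=g(x)$ for $x\ne0$. Moreover: (i) If $\mathrm{Re}\,\gamma\notin\mathbb N$ and $k=\lfloor\mathrm{Re}\,\gamma\rfloor$,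 then $g$ is bounded around $x=0$, $g\in L_p$ for all $p>\frac1{k+1-\mathrm{Re}\,\gamma}$, and there is $c>0$ with $|g(x)|\le c\,|x|^{-(k+1-\mathrm{Re}\,\gamma)}$ for all $|x|\ge1$. (ii) If $\gamma\in\mathbb N$, $h_{a,b}^{\gamma}(\omega)\equiv d\,\omega^{\gamma}$ for some $d\in\mathbb C$, and $k=\gamma$, then $g$ is bounded around $x=0$ and $g\in L_p$ for all $p>0$. (iii) If $\mathrm{Re}\,\gamma\in\mathbb N$ and $k=\mathrm{Re}\,\gamma$, but it is not the case that $\gamma\in\mathbb N$ and $h_{a,b}^{\gamma}(\omega)\equiv d\,\omega^{\gamma}$ for some $d\in\mathbb C$, then $\frac{|g(x)|}{\log|x|}$ is bounded around $x=0$, $g\in L_p$ for all $p>1$, and there is $c>0$ with $|g(x)|\le c\,\frac{1+\log|x|}{|x|}$ for all $|x|\ge1$. If in addition $\widehat\varphi^{(k-1)}(0)\neq0$, then $g$ is singular at $x=0$: it has no finite limit there, and if $\gamma\in\mathbb N$ then even $|g(x)|\to\infty$ as $x\to0$. (iv) If $\mathrm{Re}\,\gamma\notin\mathbb N$ and $k>\lfloor\mathrm{Re}\,\gamma\rfloor$,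 then $|x|^{k-\mathrm{Re}\,\gamma}|g(x)|$ is bounded around $x=0$, $g\in L_p$ for all $\frac1{k+1-\mathrm{Re}\,\gamma}<p<\frac1{k-\mathrm{Re}\,\gamma}$, and there is $c>0$ with $|g(x)|\le c\,|x|^{-(k+1-\mathrm{Re}\,\gamma)}$ for all $|x|\ge1$. (v) If $\mathrm{Re}\,\gamma\in\mathbb N$ and $k>\mathrm{Re}\,\gamma$, then $|x|^{k-\mathrm{Re}\,\gamma}|g(x)|$ is bounded around $x=0$, $g\in L_p$ for all $\frac1{k+1-\mathrm{Re}\,\gamma}<p<\frac1{k-\mathrm{Re}\,\gamma}$, and there is $c>0$ with $|g(x)|\le c\,\frac{1+\log|x|}{|x|^{k+1-\mathrm{Re}\,\gamma}}$ for all $|x|\ge1$. -/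

import Mathlib

open MeasureTheory Filter Topology

noncomputable section

namespace FracInt

/-- The Fourier transform `f̂(ω) = ∫ f(x) e^{-iωx} dx`. -/
def fourier (f : ℝ → ℂ) (ω : ℝ) : ℂ :=
  ∫ x : ℝ, f x * Complex.exp (-(Complex.I * ω * x))

/-- The inverse Fourier transform `(1/2π) ∫ f(ω) e^{iωx} dω`. -/
def fourierInv (f : ℝ → ℂ) (x : ℝ) : ℂ :=
  (1 / (2 * (Real.pi : ℂ))) * ∫ ω : ℝ, f ω * Complex.exp (Complex.I * ω * x)

/-- The homogeneous function `h_{a,b}^γ(ω) = a ω₊^γ + b ω₋^γ` (and `0` at `ω = 0`), where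
`ω_±^γ = |ω|^γ` if `±ω > 0` and `0` otherwise. -/
def homMultiplier (a b γ : ℂ) (ω : ℝ) : ℂ :=
  if 0 < ω then a * ((|ω| : ℝ) : ℂ) ^ γ
  else if ω < 0 then b * ((|ω| : ℝ) : ℂ) ^ γ
  else 0

/-- `γ` is a natural number and `h_{a,b}^γ(ω) = d ω^γ` for some constant `d`. -/
def IsPureInteger (a b γ : ℂ) : Prop :=
  ∃ n : ℕ, γ = n ∧ ∃ d : ℂ, ∀ ω : ℝ, homMultiplier a b γ ω = d * (ω : ℂ) ^ n

/-- The Fourier-domain symbol of the adjoint integrator applied to `φ`: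
`(φ̂(ω) - ∑_{j<k} φ̂^{(j)}(0) ω^j / j!) / h_{a,b}^γ(-ω)`. -/
def adjSymbol (a b γ : ℂ) (k : ℕ) (φ : SchwartzMap ℝ ℂ) (ω : ℝ) : ℂ :=
  (fourier φ ω - ∑ j ∈ Finset.range k,
      iteratedDeriv j (fourier φ) 0 / (j.factorial : ℂ) * (ω : ℂ) ^ j)
    / homMultiplier a b γ (-ω)

/-- The adjoint integrator `I_{a,b}^{(γ;k)*} φ = F⁻¹{adjSymbol}`. The symbol need not be
integrable, so the inverse Fourier transform is the one of tempered distributions: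
`⟨F⁻¹ Φ, ψ⟩ = ∫ Φ(ω) (F⁻¹ ψ)(ω) dω` for Schwartz `ψ`, with the bilinear pairing. -/
def adjIntegrator (a b γ : ℂ) (k : ℕ) (φ ψ : SchwartzMap ℝ ℂ) : ℂ :=
  ∫ ω : ℝ, adjSymbol a b γ k φ ω * fourierInv ψ ω

/-- The functional `u` on Schwartz functions is given at `ψ` by integration against `g`. -/
def RepresentedAt (u : SchwartzMap ℝ ℂ → ℂ) (g : ℝ → ℂ) (ψ : SchwartzMap ℝ ℂ) : Prop :=
  Integrable (fun x : ℝ => g x * ψ x) ∧ u ψ = ∫ x : ℝ, g x * ψ x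

/-- `f` is bounded on some punctured neighbourhood of `0`. -/
def BoundedNearZero (f : ℝ → ℝ) : Prop :=
  ∃ C : ℝ, ∀ᶠ x in 𝓝[≠] (0 : ℝ), |f x| ≤ C

/-- `g` has a non-removable singularity at `0`: it has no (finite) limit there. -/
def SingularAtZero (g : ℝ → ℂ) : Prop :=
  ¬ ∃ L : ℂ, Tendsto g (𝓝[≠] (0 : ℝ)) (𝓝 L)

end FracInt

end

/-! Write `k = n + 1` and `r(ω) = ω^k / h(-ω)`, which is homogeneous of degree `k - γ`. Taylor's
formula with integral remainder gives `Φ(ω) = (1/n!) ∫₀¹ (1-t)^n D(tω) r(ω) dt` with `D = φ̂^(k)`,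
so `Φ` is a mean of functions `D(tω) r(ω)`, each of them integrable even when `Φ` is not. By
homogeneity the inverse transform of `D(tω) r(ω)` is `t^(-σ) η(x/t)`, where `σ = k + 1 - γ` and `η =
F⁻¹(D r)` (`fourierInv_dilate`). Hence `g(x) = (1/n!) ∫₀¹ (1-t)^n t^(-σ) η(x/t) dt`; Fubini
justifies the exchange.

Integration by parts on each half-line gives `|η(x)| ≤ C (1+|x|)^(-Re σ)` (`norm_profile_le`),
whence `|g(x)| ≤ C ∫₀¹ (t+|x|)^(-Re σ) dt`. All upper bounds outside case (ii) come from this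
elementary integral: its behaviour at `0` depends on whether `Re σ` is below, at or above `1`.

For `γ = k` one has `σ = 1`, and since `η` is Lipschitz at `0`, `g(x) = (η(0)/n!) ∫₀¹
(1-t)^n/(t+|x|) dt + O(1)`. Here `η(0)` is `φ̂^(k-1)(0)` times a factor that vanishes exactly in the
pure case (`profile_natCast_zero`, `isPureInteger_natCast_iff`). In the pure case `r` is constant
off `0`, so `η` is Schwartz and `g` decays rapidly; otherwise `|g| → ∞` when `φ̂^(k-1)(0) ≠ 0`.

For non-real `γ` with `Re γ = k` the absence of a limit is proved by scaling. A limit at `0` would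
make pairings of `x ↦ g(x/R)` with a test function of zero mean tend to `0`; on the Fourier side
they reproduce, up to a factor of modulus one, the leading term `-(φ̂^(n)(0)/n!) u^n / h(-u)` of the
symbol at infinity, which is not zero. -/

noncomputable section

namespace FracInt

/-! ### Fourier transforms in angular frequency on Schwartz space -/

open FourierTransform in
/-- The Fourier transform in angular frequency, as a Schwartz function. -/
def schwartzFourier (φ : SchwartzMap ℝ ℂ) : SchwartzMap ℝ ℂ :=
  SchwartzMap.compCLMOfContinuousLinearEquiv ℂ
    (ContinuousLinearEquiv.smulLeft (R₁ := ℝ) (M₁ := ℝ)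
      (Units.mk0 (2 * Real.pi)⁻¹ (by positivity))) (𝓕 φ)

theorem schwartzFourier_apply (φ : SchwartzMap ℝ ℂ) (ω : ℝ) :
    schwartzFourier φ ω = fourier φ ω := by
  have hpi : (Real.pi : ℂ) ≠ 0 := by exact_mod_cast Real.pi_ne_zero
  simp only [schwartzFourier, SchwartzMap.compCLMOfContinuousLinearEquiv_apply,
    Function.comp_apply, SchwartzMap.fourier_coe, Real.fourier_real_eq_integral_exp_smul, fourier]
  refine integral_congr_ae (Eventually.of_forall fun x => ?_)
  simp only [ContinuousLinearEquiv.smulLeft_apply_apply, Units.smul_mk0, smul_eq_mul]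
  rw [mul_comm]
  congr 2
  push_cast
  field_simp

theorem coe_schwartzFourier (φ : SchwartzMap ℝ ℂ) : ⇑(schwartzFourier φ) = fourier φ :=
  funext (schwartzFourier_apply φ)

open FourierTransform in
/-- The inverse Fourier transform in angular frequency, on Schwartz functions. -/
def schwartzFourierInv : SchwartzMap ℝ ℂ →L[ℂ] SchwartzMap ℝ ℂ :=
  (1 / (2 * (Real.pi : ℂ))) • (SchwartzMap.compCLMOfContinuousLinearEquiv ℂ
    (ContinuousLinearEquiv.smulLeft (R₁ := ℝ) (M₁ := ℝ)
      (Units.mk0 (2 * Real.pi)⁻¹ (by positivity)))).comp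
      (fourierInvCLM ℂ (SchwartzMap ℝ ℂ))

theorem schwartzFourierInv_apply (ψ : SchwartzMap ℝ ℂ) (x : ℝ) :
    schwartzFourierInv ψ x = fourierInv ψ x := by
  have hpi : (Real.pi : ℂ) ≠ 0 := by exact_mod_cast Real.pi_ne_zero
  simp only [schwartzFourierInv, fourierInv, _root_.smul_apply,
    ContinuousLinearMap.comp_apply, FourierTransform.fourierInvCLM_apply,
    SchwartzMap.compCLMOfContinuousLinearEquiv_apply, Function.comp_apply,
    SchwartzMap.fourierInv_coe, Real.fourierInv_eq', smul_eq_mul]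
  congr 1
  refine integral_congr_ae (Eventually.of_forall fun y => ?_)
  simp only [ContinuousLinearEquiv.smulLeft_apply_apply, Units.smul_mk0, smul_eq_mul]
  rw [mul_comm]
  congr 2
  simp
  field_simp

theorem coe_schwartzFourierInv (ψ : SchwartzMap ℝ ℂ) : ⇑(schwartzFourierInv ψ) = fourierInv ψ :=
  funext (schwartzFourierInv_apply ψ)

/-- Every Schwartz function is the inverse Fourier transform of a Schwartz function. -/
theorem exists_schwartzFourierInv_eq (θ : SchwartzMap ℝ ℂ) :
    ∃ ψ, schwartzFourierInv ψ = θ := by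
  have hpi : (Real.pi : ℂ) ≠ 0 := by exact_mod_cast Real.pi_ne_zero
  refine ⟨(2 * (Real.pi : ℂ)) • FourierTransform.fourier
    (SchwartzMap.compCLMOfContinuousLinearEquiv ℂ
      (ContinuousLinearEquiv.smulLeft (R₁ := ℝ) (M₁ := ℝ)
        (Units.mk0 (2 * Real.pi) (by positivity))) θ), ?_⟩
  ext x
  rw [map_smul]
  simp only [schwartzFourierInv, _root_.smul_apply, ContinuousLinearMap.comp_apply,
    FourierTransform.fourierInvCLM_apply, FourierTransform.fourierInv_fourier_eq,
    SchwartzMap.compCLMOfContinuousLinearEquiv_apply, Function.comp_apply,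
    ContinuousLinearEquiv.smulLeft_apply_apply, Units.smul_mk0, smul_eq_mul]
  rw [mul_inv_cancel_left₀ (by positivity)]
  field_simp

/-! ### Derivatives, Taylor's formula and decay of Schwartz functions -/

/-- The iterated derivative of a Schwartz function as a Schwartz function. -/
def schwartzDeriv (k : ℕ) (f : SchwartzMap ℝ ℂ) : SchwartzMap ℝ ℂ :=
  (SchwartzMap.derivCLM ℂ ℂ)^[k] f

theorem coe_schwartzDeriv (k : ℕ) (f : SchwartzMap ℝ ℂ) :
    ⇑(schwartzDeriv k f) = iteratedDeriv k f := by
  induction k with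
  | zero => simp [schwartzDeriv]
  | succ k ih =>
    rw [iteratedDeriv_succ, ← ih]
    ext x
    simp [schwartzDeriv, Function.iterate_succ_apply']

theorem hasDerivAt_schwartzDeriv (k : ℕ) (f : SchwartzMap ℝ ℂ) (x : ℝ) :
    HasDerivAt (schwartzDeriv k f) (schwartzDeriv (k + 1) f x) x := by
  rw [coe_schwartzDeriv (k + 1), iteratedDeriv_succ, ← coe_schwartzDeriv k]
  exact (schwartzDeriv k f).differentiableAt.hasDerivAt

/-- Induction on `n`, integrating by parts in `t`. With the interval normalised to `[0, 1]`, `ω`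
enters the integral only through a dilation of the derivative, which is what the scaling argument
needs. -/
theorem taylor_remainder_eq (n : ℕ) (f : SchwartzMap ℝ ℂ) (ω : ℝ) :
    f ω - ∑ j ∈ Finset.range (n + 1), iteratedDeriv j f 0 / (j.factorial : ℂ) * (ω : ℂ) ^ j =
      (ω : ℂ) ^ (n + 1) / (n.factorial : ℂ) *
        ∫ t in (0 : ℝ)..1, ((1 - t : ℝ) : ℂ) ^ n * schwartzDeriv (n + 1) f (t * ω) := by
  have hcont : ∀ m, Continuous fun t : ℝ => schwartzDeriv m f (t * ω) := fun m =>
    (schwartzDeriv m f).continuous.comp (continuous_mul_const ω)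
  have hd : ∀ m (t : ℝ), HasDerivAt (fun t : ℝ => schwartzDeriv m f (t * ω))
      (ω * schwartzDeriv (m + 1) f (t * ω)) t := fun m t => by
    have h := (hasDerivAt_schwartzDeriv m f (t * ω)).scomp t (hasDerivAt_mul_const ω)
    rw [Complex.real_smul] at h
    exact h
  induction n with
  | zero =>
    have h := intervalIntegral.integral_eq_sub_of_hasDerivAt (a := 0) (b := 1)
      (fun t _ => hd 0 t) ((continuous_const.mul (hcont 1)).intervalIntegrable _ _)
    rw [intervalIntegral.integral_const_mul] at h
    have h0 : schwartzDeriv 0 f = f := rfl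
    rw [h0, one_mul, zero_mul] at h
    simp [← h]
  | succ n ih =>
    have hu : ∀ t : ℝ, HasDerivAt (fun t : ℝ => ((1 - t : ℝ) : ℂ) ^ (n + 1))
        (-((n + 1 : ℂ) * ((1 - t : ℝ) : ℂ) ^ n)) t := fun t => by
      have h1 : HasDerivAt (fun t : ℝ => ((1 - t : ℝ) : ℂ)) (-1) t := by
        simpa using ((hasDerivAt_id t).const_sub 1).ofReal_comp
      convert! h1.pow (n + 1) using 1
      simp
    have h := intervalIntegral.integral_mul_deriv_eq_deriv_mul (a := 0) (b := 1)
      (fun t _ => hu t) (fun t _ => hd (n + 1) t)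
      (Continuous.intervalIntegrable (by fun_prop) _ _)
      ((continuous_const.mul (hcont (n + 2))).intervalIntegrable _ _)
    have e1 : (fun t : ℝ => ((1 - t : ℝ) : ℂ) ^ (n + 1) * (ω * schwartzDeriv (n + 1 + 1) f (t * ω)))
        = fun t : ℝ => (ω : ℂ) *
          (((1 - t : ℝ) : ℂ) ^ (n + 1) * schwartzDeriv (n + 1 + 1) f (t * ω)) := by
      ext t; ring
    have e2 : (fun t : ℝ => -((n + 1 : ℂ) * ((1 - t : ℝ) : ℂ) ^ n) * schwartzDeriv (n + 1) f (t * ω))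
        = fun t : ℝ => (-(n + 1 : ℂ)) *
          (((1 - t : ℝ) : ℂ) ^ n * schwartzDeriv (n + 1) f (t * ω)) := by
      ext t; ring
    rw [e1, e2, intervalIntegral.integral_const_mul, intervalIntegral.integral_const_mul] at h
    have hz : schwartzDeriv (n + 1) f 0 = iteratedDeriv (n + 1) f 0 := by rw [coe_schwartzDeriv]
    simp only [sub_self, Complex.ofReal_zero, zero_mul, sub_zero, Complex.ofReal_one, one_pow,
      one_mul, hz, ne_eq, Nat.add_eq_zero_iff, one_ne_zero, and_false, not_false_eq_true,
      zero_pow] at h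
    rw [Finset.sum_range_succ, ← sub_sub, ih, Nat.factorial_succ]
    have hn : (n.factorial : ℂ) ≠ 0 := by exact_mod_cast n.factorial_ne_zero
    have hn1 : (n + 1 : ℂ) ≠ 0 := by exact_mod_cast n.succ_ne_zero
    rw [pow_succ (ω : ℂ) (n + 1)]
    rw [Nat.cast_mul, Nat.cast_succ, div_mul_eq_mul_div ((ω : ℂ) ^ (n + 1) * ω), mul_assoc ((ω : ℂ) ^ (n + 1)), h]
    generalize (∫ t in (0 : ℝ)..1, ((1 - t : ℝ) : ℂ) ^ n * schwartzDeriv (n + 1) f (t * ω)) = J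
    field_simp
    ring

/-- A Schwartz function decays faster than any real power. -/
theorem exists_schwartz_norm_le_rpow (f : SchwartzMap ℝ ℂ) (q : ℝ) (hq : 0 ≤ q) :
    ∃ C, 0 < C ∧ ∀ x : ℝ, x ≠ 0 → ‖f x‖ ≤ C * |x| ^ (-q) := by
  obtain ⟨C₀, h₀, hC₀⟩ := f.decay 0 0
  obtain ⟨C₁, h₁, hC₁⟩ := f.decay ⌈q⌉₊ 0
  refine ⟨C₀ + C₁, by positivity, fun x hx => ?_⟩
  have hx' : 0 < |x| := abs_pos.2 hx
  have e0 := hC₀ x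
  have e1 := hC₁ x
  simp only [pow_zero, one_mul, norm_iteratedFDeriv_zero, Real.norm_eq_abs] at e0 e1
  rw [Real.rpow_neg hx'.le, ← div_eq_mul_inv, le_div_iff₀ (by positivity)]
  rcases le_total |x| 1 with h | h
  · have := Real.rpow_le_one hx'.le h hq
    nlinarith [norm_nonneg (f x)]
  · have h2 : |x| ^ q ≤ |x| ^ ⌈q⌉₊ := by
      rw [← Real.rpow_natCast]
      exact Real.rpow_le_rpow_of_exponent_le h (Nat.le_ceil q)
    nlinarith [norm_nonneg (f x)]

/-! ### One-sided oscillatory integrals and their decay -/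

open Set

/-- The integrand `ω^β f(ω) e^{iωx}` of a one-sided inverse Fourier integral. -/
def oneSided (β : ℂ) (f : SchwartzMap ℝ ℂ) (x ω : ℝ) : ℂ :=
  (ω : ℂ) ^ β * f ω * Complex.exp (Complex.I * ω * x)

theorem norm_exp_I_mul (ω x : ℝ) : ‖Complex.exp (Complex.I * ω * x)‖ = 1 := by
  rw [mul_assoc, mul_comm, ← Complex.ofReal_mul, Complex.norm_exp_ofReal_mul_I]

theorem norm_oneSided {β : ℂ} {f : SchwartzMap ℝ ℂ} {x ω : ℝ} (hω : 0 < ω) :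
    ‖oneSided β f x ω‖ = ω ^ β.re * ‖f ω‖ := by
  rw [oneSided, norm_mul, norm_exp_I_mul, mul_one, norm_mul,
    Complex.norm_cpow_eq_rpow_re_of_pos hω]

/-- Schwartz decay absorbs the power of `ω`, uniformly in `x` because the exponential is unimodular.
Any large `p` is allowed, in particular one above `1`. -/
theorem norm_oneSided_le (β : ℂ) (f : SchwartzMap ℝ ℂ) {p : ℝ} (hp : 0 ≤ p + β.re) :
    ∃ C, 0 < C ∧ ∀ x ω : ℝ, 0 < ω → ‖oneSided β f x ω‖ ≤ C * ω ^ (-p) := by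
  obtain ⟨C, hC, h⟩ := exists_schwartz_norm_le_rpow f (p + β.re) hp
  refine ⟨C, hC, fun x ω hω => ?_⟩
  rw [norm_oneSided hω]
  calc ω ^ β.re * ‖f ω‖ ≤ ω ^ β.re * (C * |ω| ^ (-(p + β.re))) := by
        gcongr; exact h ω hω.ne'
    _ = C * (ω ^ β.re * ω ^ (-(p + β.re))) := by rw [abs_of_pos hω]; ring
    _ = C * ω ^ (-p) := by rw [← Real.rpow_add hω]; ring_nf

/-- This is the integration by parts identity: `x` times the integrand is expressed through
integrands of the same family, with `β` lowered by one or `f` differentiated. -/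
theorem hasDerivAt_oneSided (β : ℂ) (f : SchwartzMap ℝ ℂ) (x : ℝ) {ω : ℝ} (hω : 0 < ω) :
    HasDerivAt (oneSided β f x)
      (β * oneSided (β - 1) f x ω + oneSided β (schwartzDeriv 1 f) x ω
        + Complex.I * x * oneSided β f x ω) ω := by
  have h1 : HasDerivAt (fun ω : ℝ => (ω : ℂ) ^ β) (β * (ω : ℂ) ^ (β - 1)) ω :=
    (Complex.hasStrictDerivAt_cpow_const (Complex.ofReal_mem_slitPlane.2 hω)).hasDerivAt.comp_ofReal
  have h2 : HasDerivAt f (schwartzDeriv 1 f ω) ω := hasDerivAt_schwartzDeriv 0 f ω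
  have h3 : HasDerivAt (fun ω : ℝ => Complex.exp (Complex.I * ω * x))
      (Complex.exp (Complex.I * ω * x) * (Complex.I * x)) ω := by
    have : HasDerivAt (fun ω : ℂ => Complex.I * ω * x) (Complex.I * x) (ω : ℂ) := by
      simpa using ((hasDerivAt_id (ω : ℂ)).const_mul Complex.I).mul_const (x : ℂ)
    exact this.cexp.comp_ofReal
  refine ((h1.mul h2).mul h3).congr_deriv ?_
  simp only [oneSided, Pi.mul_apply]
  ring

theorem continuousOn_oneSided (β : ℂ) (f : SchwartzMap ℝ ℂ) (x : ℝ) :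
    ContinuousOn (oneSided β f x) (Ioi 0) :=
  fun _ hω => (hasDerivAt_oneSided β f x hω).continuousAt.continuousWithinAt

theorem aestronglyMeasurable_oneSided (β : ℂ) (f : SchwartzMap ℝ ℂ) (x : ℝ) {δ : ℝ} (hδ : 0 ≤ δ) :
    AEStronglyMeasurable (oneSided β f x) (volume.restrict (Ioi δ)) :=
  ((continuousOn_oneSided β f x).mono (Ioi_subset_Ioi hδ)).aestronglyMeasurable measurableSet_Ioi

/-- A decay exponent for `oneSided` which is integrable at infinity. -/
theorem one_lt_tailExponent (β : ℂ) : 1 < max (3 / 2) (-β.re) := by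
  have := le_max_left (3 / 2) (-β.re); linarith

theorem tailExponent_add_nonneg (β : ℂ) : 0 ≤ max (3 / 2) (-β.re) + β.re := by
  have := le_max_right (3 / 2) (-β.re); linarith

theorem integrableOn_oneSided_tail (β : ℂ) (f : SchwartzMap ℝ ℂ) (x : ℝ) {δ : ℝ} (hδ : 0 < δ) :
    IntegrableOn (oneSided β f x) (Ioi δ) := by
  obtain ⟨C, -, h⟩ := norm_oneSided_le β f (tailExponent_add_nonneg β)
  refine Integrable.mono' ((integrableOn_Ioi_rpow_of_lt
    (neg_lt_neg (one_lt_tailExponent β)) hδ).const_mul C)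
    (aestronglyMeasurable_oneSided β f x hδ.le) ?_
  exact (ae_restrict_iff' measurableSet_Ioi).2 (Eventually.of_forall fun ω hω =>
    h x ω (hδ.trans hω))

theorem tendsto_oneSided_atTop (β : ℂ) (f : SchwartzMap ℝ ℂ) (x : ℝ) :
    Tendsto (oneSided β f x) atTop (𝓝 0) := by
  obtain ⟨C, -, h⟩ := norm_oneSided_le β f (tailExponent_add_nonneg β)
  have hp := one_lt_tailExponent β
  refine squeeze_zero_norm' (eventually_atTop.2 ⟨1, fun ω hω => h x ω (by linarith)⟩) ?_
  simpa using (tendsto_rpow_neg_atTop (by linarith : 0 < max (3 / 2) (-β.re))).const_mul C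

/-- Decay of the tail `∫_{1/|x|}^∞ ω^β f(ω) e^{iωx} dω`. -/
theorem norm_integral_oneSided_tail_le (N : ℕ) : ∀ (β : ℂ) (f : SchwartzMap ℝ ℂ),
    ∃ C, 0 < C ∧ ∀ x : ℝ, 1 ≤ |x| →
      ‖∫ ω in Ioi |x|⁻¹, oneSided β f x ω‖ ≤ C * (|x| ^ (-1 - β.re) + |x| ^ (1 / 2 - (N : ℝ))) := by
  induction N with
  -- Absolute values suffice: the integral of `ω^(-p)` over the tail is `|x|^(p-1)/(p-1)`, and `p -
  -- 1` equals either `1/2` or `-1 - Re β`, the two exponents in the claim.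
  | zero =>
    intro β f
    set p := max (3 / 2) (-β.re) with hp_def
    have hp : 1 < p := one_lt_tailExponent β
    obtain ⟨C, hC, h⟩ := norm_oneSided_le β f (tailExponent_add_nonneg β)
    refine ⟨C * (1 / (p - 1)), mul_pos hC (one_div_pos.2 (by linarith)), fun x hx => ?_⟩
    have hx0 : 0 < |x| := by linarith
    have hδ : 0 < |x|⁻¹ := inv_pos.2 hx0
    have hmain : ‖∫ ω in Ioi |x|⁻¹, oneSided β f x ω‖ ≤ ∫ ω in Ioi |x|⁻¹, C * ω ^ (-p) :=
      norm_integral_le_of_norm_le ((integrableOn_Ioi_rpow_of_lt (by linarith) hδ).const_mul C)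
        ((ae_restrict_iff' measurableSet_Ioi).2 (Eventually.of_forall fun ω hω =>
          h x ω (hδ.trans hω)))
    rw [integral_const_mul, integral_Ioi_rpow_of_lt (by linarith) hδ] at hmain
    refine hmain.trans ?_
    have e : C * (-|x|⁻¹ ^ (-p + 1) / (-p + 1)) = C * (1 / (p - 1)) * |x| ^ (p - 1) := by
      rw [Real.inv_rpow hx0.le, ← Real.rpow_neg hx0.le, neg_add, neg_neg, neg_div,
        ← div_neg, neg_add, neg_neg, ← sub_eq_add_neg]
      ring
    rw [e]
    have hpc : 0 < 1 / (p - 1) := one_div_pos.2 (by linarith)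
    refine mul_le_mul_of_nonneg_left ?_ (by positivity)
    have h1 : 0 ≤ |x| ^ (-1 - β.re) := by positivity
    have h2 : 0 ≤ |x| ^ (1 / 2 - ((0 : ℕ) : ℝ)) := by positivity
    rcases max_choice (3 / 2) (-β.re) with hm | hm
    · have : p - 1 = 1 / 2 - ((0 : ℕ) : ℝ) := by rw [hp_def, hm]; norm_num
      rw [this]; linarith
    · have : p - 1 = -1 - β.re := by rw [hp_def, hm]; ring
      rw [this]; linarith
  -- Each integration by parts gains a factor `1/|x|`. The boundary term at `1/|x|` has size
  -- `|x|^(-Re β)`, which after the gain is the first exponent. Since `β` drops to `β - 1`, the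
  -- induction must run over all `β`; the cut-off at `1/|x|` is what makes this harmless.
  | succ N ih =>
    intro β f
    obtain ⟨C₁, hC₁, h₁⟩ := ih (β - 1) f
    obtain ⟨C₂, hC₂, h₂⟩ := ih β (schwartzDeriv 1 f)
    obtain ⟨C₃, hC₃, h₃⟩ := f.decay 0 0
    refine ⟨C₃ + ‖β‖ * C₁ + C₂, by positivity, fun x hx => ?_⟩
    have hx0 : 0 < |x| := by linarith
    have hδ : 0 < |x|⁻¹ := inv_pos.2 hx0
    have i1 := (integrableOn_oneSided_tail (β - 1) f x hδ).const_mul β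
    have i2 := integrableOn_oneSided_tail β (schwartzDeriv 1 f) x hδ
    have i3 := (integrableOn_oneSided_tail β f x hδ).const_mul (Complex.I * x)
    have hparts := integral_Ioi_of_hasDerivAt_of_tendsto'
      (fun ω (hω : ω ∈ Ici |x|⁻¹) => hasDerivAt_oneSided β f x (hδ.trans_le hω))
      ((i1.add i2).add i3) (tendsto_oneSided_atTop β f x)
    have hadd := (integral_add (i1.add i2) i3).trans
      (congrArg (· + _) (integral_add i1 i2))
    simp only [Pi.add_apply] at hadd
    rw [hadd, integral_const_mul, integral_const_mul] at hparts
    have hB : ‖oneSided β f x |x|⁻¹‖ ≤ C₃ * |x| ^ (-β.re) := by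
      rw [norm_oneSided hδ, Real.inv_rpow hx0.le, ← Real.rpow_neg hx0.le, mul_comm]
      gcongr
      simpa using h₃ |x|⁻¹
    have key : |x| * ‖∫ ω in Ioi |x|⁻¹, oneSided β f x ω‖ ≤
        C₃ * |x| ^ (-β.re) + ‖β‖ * (C₁ * (|x| ^ (-β.re) + |x| ^ (1 / 2 - (N : ℝ)))) +
          C₂ * (|x| ^ (-β.re) + |x| ^ (1 / 2 - (N : ℝ))) := by
      have e : |x| * ‖∫ ω in Ioi |x|⁻¹, oneSided β f x ω‖ =
          ‖-oneSided β f x |x|⁻¹ - β * (∫ ω in Ioi |x|⁻¹, oneSided (β - 1) f x ω)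
            - ∫ ω in Ioi |x|⁻¹, oneSided β (schwartzDeriv 1 f) x ω‖ := by
        have : Complex.I * x * (∫ ω in Ioi |x|⁻¹, oneSided β f x ω) =
            -oneSided β f x |x|⁻¹ - β * (∫ ω in Ioi |x|⁻¹, oneSided (β - 1) f x ω)
            - ∫ ω in Ioi |x|⁻¹, oneSided β (schwartzDeriv 1 f) x ω := by
          linear_combination hparts
        rw [← this, norm_mul, norm_mul, Complex.norm_I, one_mul, Complex.norm_real,
          Real.norm_eq_abs]
      rw [e]
      refine (norm_sub_le _ _).trans (add_le_add ((norm_sub_le _ _).trans (add_le_add ?_ ?_)) ?_)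
      · rwa [norm_neg]
      · rw [norm_mul]
        gcongr
        have hexp : -1 - (β - 1).re = -β.re := by rw [Complex.sub_re, Complex.one_re]; ring
        simpa only [hexp] using h₁ x hx
      · refine (h₂ x hx).trans ?_
        gcongr
        linarith
    have a1 : |x| ^ (-β.re) = |x| * |x| ^ (-1 - β.re) := by
      nth_rewrite 2 [← Real.rpow_one |x|]
      rw [← Real.rpow_add hx0]
      ring_nf
    have a2 : |x| ^ (1 / 2 - (N : ℝ)) = |x| * |x| ^ (1 / 2 - ((N + 1 : ℕ) : ℝ)) := by
      nth_rewrite 2 [← Real.rpow_one |x|]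
      rw [← Real.rpow_add hx0]
      congr 1; push_cast; ring
    rw [a1, a2] at key
    refine le_of_mul_le_mul_left (key.trans ?_) hx0
    have q1 : 0 ≤ |x| * |x| ^ (-1 - β.re) := by positivity
    have q2 : 0 ≤ |x| * |x| ^ (1 / 2 - ((N + 1 : ℕ) : ℝ)) := by positivity
    nlinarith [mul_nonneg hC₃.le q2]

theorem integrableOn_oneSided {β : ℂ} (hβ : -1 < β.re) (f : SchwartzMap ℝ ℂ) (x : ℝ) :
    IntegrableOn (oneSided β f x) (Ioi 0) := by
  rw [← Ioc_union_Ioi_eq_Ioi zero_le_one]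
  refine IntegrableOn.union ?_ (integrableOn_oneSided_tail β f x one_pos)
  obtain ⟨C, -, h⟩ := f.decay 0 0
  have hi := (intervalIntegral.intervalIntegrable_rpow' (a := 0) (b := 1) hβ).1
  refine Integrable.mono' (hi.const_mul C)
    ((aestronglyMeasurable_oneSided β f x le_rfl).mono_set Ioc_subset_Ioi_self) ?_
  refine (ae_restrict_iff' measurableSet_Ioc).2 (Eventually.of_forall fun ω hω => ?_)
  rw [norm_oneSided hω.1, mul_comm]
  have := h ω
  simp only [pow_zero, one_mul, norm_iteratedFDeriv_zero] at this
  exact mul_le_mul_of_nonneg_right this (Real.rpow_nonneg hω.1.le _)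

/-- Decay of the one-sided Fourier integral. -/
theorem norm_integral_oneSided_le {β : ℂ} (hβ : -1 < β.re) (f : SchwartzMap ℝ ℂ) :
    ∃ C, 0 < C ∧ ∀ x : ℝ, 1 ≤ |x| →
      ‖∫ ω in Ioi 0, oneSided β f x ω‖ ≤ C * |x| ^ (-1 - β.re) := by
  -- This many integrations by parts make `1/2 - N ≤ -1 - Re β`, so the tail is dominated by the
  -- expected power.
  obtain ⟨N, hN⟩ := exists_nat_ge (β.re + 3 / 2)
  obtain ⟨C₁, hC₁, h₁⟩ := norm_integral_oneSided_tail_le N β f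
  obtain ⟨C₂, hC₂, h₂⟩ := f.decay 0 0
  have hb : 0 < β.re + 1 := by linarith
  refine ⟨C₂ * (1 / (β.re + 1)) + 2 * C₁, by positivity, fun x hx => ?_⟩
  have hx0 : 0 < |x| := by linarith
  have hδ : 0 < |x|⁻¹ := inv_pos.2 hx0
  have hi := integrableOn_oneSided hβ f x
  rw [← Ioc_union_Ioi_eq_Ioi hδ.le] at hi ⊢
  rw [setIntegral_union (Set.Ioc_disjoint_Ioi le_rfl) measurableSet_Ioi
    (hi.mono_set subset_union_left) (hi.mono_set subset_union_right)]
  -- No oscillation is needed on `(0, 1/|x|]`: integrating `ω^(Re β)` there already yields `|x|^(-1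
  -- - Re β)`.
  have hs : ‖∫ ω in Ioc 0 |x|⁻¹, oneSided β f x ω‖ ≤ ∫ ω in Ioc 0 |x|⁻¹, C₂ * ω ^ β.re := by
    refine norm_integral_le_of_norm_le
      ((intervalIntegral.intervalIntegrable_rpow' (a := 0) (b := |x|⁻¹) hβ).1.const_mul C₂)
      ((ae_restrict_iff' measurableSet_Ioc).2 (Eventually.of_forall fun ω hω => ?_))
    rw [norm_oneSided hω.1, mul_comm]
    have := h₂ ω
    simp only [pow_zero, one_mul, norm_iteratedFDeriv_zero] at this
    exact mul_le_mul_of_nonneg_right this (Real.rpow_nonneg hω.1.le _)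
  rw [integral_const_mul, ← intervalIntegral.integral_of_le (f := fun ω : ℝ => ω ^ β.re) hδ.le, integral_rpow (Or.inl hβ),
    Real.zero_rpow hb.ne', sub_zero, Real.inv_rpow hx0.le, ← Real.rpow_neg hx0.le,
    show -(β.re + 1) = -1 - β.re by ring] at hs
  have ht := h₁ x hx
  have hle : |x| ^ (1 / 2 - (N : ℝ)) ≤ |x| ^ (-1 - β.re) :=
    Real.rpow_le_rpow_of_exponent_le hx (by linarith)
  refine (norm_add_le _ _).trans ((add_le_add hs ht).trans ?_)
  have e : C₂ * (|x| ^ (-1 - β.re) / (β.re + 1)) = C₂ * (1 / (β.re + 1)) * |x| ^ (-1 - β.re) := by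
    ring
  rw [e]
  nlinarith

/-! ### Splitting into half-lines; the homogeneous quotient -/

theorem integrable_of_Ioi_of_comp_neg {E : Type*} [NormedAddCommGroup E] {f : ℝ → E} (h : IntegrableOn f (Ioi 0))
    (h' : IntegrableOn (fun x => f (-x)) (Ioi 0)) : Integrable f := by
  rw [← integrableOn_univ, ← Iic_union_Ioi (a := (0 : ℝ))]
  refine IntegrableOn.union ?_ h
  rw [integrableOn_Iic_iff_integrableOn_Iio]
  have h2 : IntegrableOn (fun x => f (-x)) (Ioi (-0)) := by simpa using h'
  simpa using h2.comp_neg_Iio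

theorem integral_eq_Ioi_add_comp_neg {f : ℝ → ℂ} (h : Integrable f) :
    ∫ x, f x = (∫ x in Ioi 0, f x) + ∫ x in Ioi 0, f (-x) := by
  rw [integral_comp_neg_Ioi, neg_zero, add_comm]
  exact (intervalIntegral.integral_Iic_add_Ioi h.integrableOn h.integrableOn).symm

/-- Reflection of a Schwartz function. -/
def schwartzReflect (f : SchwartzMap ℝ ℂ) : SchwartzMap ℝ ℂ :=
  SchwartzMap.compCLMOfContinuousLinearEquiv ℂ (ContinuousLinearEquiv.neg ℝ) f

@[simp]
theorem schwartzReflect_apply (f : SchwartzMap ℝ ℂ) (x : ℝ) : schwartzReflect f x = f (-x) := rfl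

/-- The quotient `ω^k / h_{a,b}^γ(-ω)`. -/
def symbolRatio (a b γ : ℂ) (k : ℕ) (ω : ℝ) : ℂ := (ω : ℂ) ^ k / homMultiplier a b γ (-ω)

theorem symbolRatio_of_pos (a b γ : ℂ) (k : ℕ) {ω : ℝ} (hω : 0 < ω) :
    symbolRatio a b γ k ω = 1 / b * (ω : ℂ) ^ ((k : ℂ) - γ) := by
  have h0 : (ω : ℂ) ≠ 0 := by exact_mod_cast hω.ne'
  rw [symbolRatio, homMultiplier, if_neg (by linarith), if_pos (by linarith), abs_neg,
    abs_of_pos hω, Complex.cpow_sub _ _ h0, Complex.cpow_natCast]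
  ring

theorem symbolRatio_neg_of_pos (a b γ : ℂ) (k : ℕ) {ω : ℝ} (hω : 0 < ω) :
    symbolRatio a b γ k (-ω) = (-1) ^ k / a * (ω : ℂ) ^ ((k : ℂ) - γ) := by
  have h0 : (ω : ℂ) ≠ 0 := by exact_mod_cast hω.ne'
  rw [symbolRatio, homMultiplier, neg_neg, if_pos hω, abs_of_pos hω, Complex.cpow_sub _ _ h0,
    Complex.cpow_natCast, Complex.ofReal_neg, neg_pow]
  ring

theorem symbolRatio_zero (a b γ : ℂ) (k : ℕ) : symbolRatio a b γ k 0 = 0 := by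
  simp [symbolRatio, homMultiplier]

theorem measurable_homMultiplier (a b γ : ℂ) : Measurable (homMultiplier a b γ) := by
  unfold homMultiplier
  refine Measurable.ite (measurableSet_lt measurable_const measurable_id) (by fun_prop)
    (Measurable.ite (measurableSet_lt measurable_id measurable_const) (by fun_prop) (by fun_prop))

theorem measurable_symbolRatio (a b γ : ℂ) (k : ℕ) : Measurable (symbolRatio a b γ k) := by
  have h : Measurable fun ω : ℝ => homMultiplier a b γ (-ω) :=
    (measurable_homMultiplier a b γ).comp measurable_neg
  unfold symbolRatio
  fun_prop

@[elab_as_elim]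
theorem real_sign_cases {P : ℝ → Prop} (h0 : P 0) (hp : ∀ ω, 0 < ω → P ω)
    (hn : ∀ ω, 0 < ω → P (-ω)) (ω : ℝ) : P ω := by
  rcases lt_trichotomy ω 0 with h | rfl | h
  · simpa using hn (-ω) (by linarith)
  · exact h0
  · exact hp ω h

theorem norm_symbolRatio_le (a b γ : ℂ) (k : ℕ) (ω : ℝ) :
    ‖symbolRatio a b γ k ω‖ ≤ (‖1 / b‖ + ‖1 / a‖) * |ω| ^ ((k : ℝ) - γ.re) := by
  have hre : ((k : ℂ) - γ).re = (k : ℝ) - γ.re := by simp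
  refine real_sign_cases ?_ (fun ω hω => ?_) (fun ω hω => ?_) ω
  · rw [symbolRatio_zero, norm_zero]; positivity
  · rw [symbolRatio_of_pos _ _ _ _ hω, norm_mul, Complex.norm_cpow_eq_rpow_re_of_pos hω, hre,
      abs_of_pos hω]
    gcongr
    linarith [norm_nonneg (1 / a)]
  · rw [symbolRatio_neg_of_pos _ _ _ _ hω, norm_mul, Complex.norm_cpow_eq_rpow_re_of_pos hω, hre,
      abs_neg, abs_of_pos hω]
    gcongr
    rw [norm_div, norm_pow, norm_neg, norm_one, one_pow, norm_div, norm_one, norm_div, norm_one]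
    linarith [one_div_nonneg.2 (norm_nonneg b)]

/-- Homogeneity of complex degree `k - γ` under positive dilations, the source of the weight
`t^(-σ)` in the formula for `g`. -/
theorem symbolRatio_mul (a b γ : ℂ) (k : ℕ) {t : ℝ} (ht : 0 < t) (ω : ℝ) :
    symbolRatio a b γ k (t * ω) = (t : ℂ) ^ ((k : ℂ) - γ) * symbolRatio a b γ k ω := by
  refine real_sign_cases ?_ (fun ω hω => ?_) (fun ω hω => ?_) ω
  · simp [symbolRatio_zero]
  · rw [symbolRatio_of_pos _ _ _ _ hω, symbolRatio_of_pos _ _ _ _ (mul_pos ht hω),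
      Complex.ofReal_mul, Complex.mul_cpow_ofReal_nonneg ht.le hω.le]
    ring
  · rw [mul_neg, symbolRatio_neg_of_pos _ _ _ _ hω, symbolRatio_neg_of_pos _ _ _ _ (mul_pos ht hω),
      Complex.ofReal_mul, Complex.mul_cpow_ofReal_nonneg ht.le hω.le]
    ring

theorem integrable_rpow_mul_schwartz {p : ℝ} (hp : -1 < p) (f : SchwartzMap ℝ ℂ) :
    Integrable fun ω : ℝ => |ω| ^ p * ‖f ω‖ := by
  have key : ∀ f : SchwartzMap ℝ ℂ, IntegrableOn (fun ω : ℝ => ((|ω| ^ p * ‖f ω‖ : ℝ) : ℂ))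
      (Ioi 0) := fun f => by
    have h := (integrableOn_oneSided (β := (p : ℂ)) (by simpa using hp) f 0).norm
    refine Integrable.ofReal (h.congr ?_)
    refine (ae_restrict_iff' measurableSet_Ioi).2 (Eventually.of_forall fun ω hω => ?_)
    dsimp only
    rw [norm_oneSided hω, abs_of_pos hω]
    rfl
  have h := integrable_of_Ioi_of_comp_neg (key f) (by simpa using key (schwartzReflect f))
  simpa using h.re

/-- The function `D(ω) ω^k / h(-ω)` is integrable for every Schwartz function `D`. -/
theorem integrable_mul_symbolRatio (a b : ℂ) {γ : ℂ} {k : ℕ} (hk : -1 < (k : ℝ) - γ.re)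
    (D : SchwartzMap ℝ ℂ) : Integrable fun ω : ℝ => D ω * symbolRatio a b γ k ω := by
  refine ((integrable_rpow_mul_schwartz hk D).const_mul (‖1 / b‖ + ‖1 / a‖)).mono'
    (D.continuous.measurable.mul (measurable_symbolRatio a b γ k)).aestronglyMeasurable
    (Eventually.of_forall fun ω => ?_)
  rw [norm_mul]
  have := mul_le_mul_of_nonneg_left (norm_symbolRatio_le a b γ k ω) (norm_nonneg (D ω))
  linarith

/-! ### The profile: continuity, decay, Lipschitz bound at the origin -/

/-- The inverse Fourier transform of `D(ω) ω^k / h(-ω)`. -/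
def profile (a b γ : ℂ) (k : ℕ) (D : SchwartzMap ℝ ℂ) (x : ℝ) : ℂ :=
  fourierInv (fun ω => D ω * symbolRatio a b γ k ω) x

theorem integrable_mul_exp {f : ℝ → ℂ} (hf : Integrable f) (x : ℝ) :
    Integrable fun ω : ℝ => f ω * Complex.exp (Complex.I * ω * x) := by
  refine hf.norm.mono' (hf.1.mul (Continuous.aestronglyMeasurable (by fun_prop)))
    (Eventually.of_forall fun ω => ?_)
  rw [norm_mul, norm_exp_I_mul, mul_one]

theorem continuous_fourierInv {f : ℝ → ℂ} (hf : Integrable f) : Continuous (fourierInv f) := by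
  unfold fourierInv
  refine continuous_const.mul (continuous_of_dominated (bound := fun ω => ‖f ω‖)
    (fun x => (integrable_mul_exp hf x).1)
    (fun x => Eventually.of_forall fun ω => ?_) hf.norm
    (Eventually.of_forall fun ω => by fun_prop))
  rw [norm_mul, norm_exp_I_mul, mul_one]

theorem norm_one_div_two_pi_le : ‖(1 / (2 * (Real.pi : ℂ)))‖ ≤ 1 := by
  rw [norm_div, norm_one, norm_mul, Complex.norm_ofNat, Complex.norm_real, Real.norm_eq_abs,
    abs_of_pos Real.pi_pos, div_le_one (by positivity)]
  linarith [Real.pi_gt_three]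

theorem norm_fourierInv_le (f : ℝ → ℂ) (x : ℝ) : ‖fourierInv f x‖ ≤ ∫ ω, ‖f ω‖ := by
  rw [fourierInv, norm_mul]
  refine (mul_le_of_le_one_left (norm_nonneg _) norm_one_div_two_pi_le).trans ?_
  refine (norm_integral_le_integral_norm _).trans (le_of_eq ?_)
  simp_rw [norm_mul, norm_exp_I_mul, mul_one]

theorem continuous_profile (a b : ℂ) {γ : ℂ} {k : ℕ} (hk : -1 < (k : ℝ) - γ.re)
    (D : SchwartzMap ℝ ℂ) : Continuous (profile a b γ k D) :=
  continuous_fourierInv (integrable_mul_symbolRatio a b hk D)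

theorem profile_eq (a b : ℂ) {γ : ℂ} {k : ℕ} (hk : -1 < (k : ℝ) - γ.re)
    (D : SchwartzMap ℝ ℂ) (x : ℝ) :
    profile a b γ k D x = 1 / (2 * (Real.pi : ℂ)) *
      (1 / b * (∫ ω in Ioi 0, oneSided ((k : ℂ) - γ) D x ω) +
        (-1) ^ k / a * ∫ ω in Ioi 0, oneSided ((k : ℂ) - γ) (schwartzReflect D) (-x) ω) := by
  rw [profile, fourierInv,
    integral_eq_Ioi_add_comp_neg (integrable_mul_exp (integrable_mul_symbolRatio a b hk D) x),
    ← integral_const_mul, ← integral_const_mul]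
  congr 2
  · refine setIntegral_congr_fun measurableSet_Ioi fun ω hω => ?_
    simp only [symbolRatio_of_pos a b γ k hω, oneSided]
    ring
  · refine setIntegral_congr_fun measurableSet_Ioi fun ω hω => ?_
    simp only [symbolRatio_neg_of_pos a b γ k hω, oneSided, schwartzReflect_apply]
    push_cast
    ring_nf

theorem exists_norm_le_one_add_rpow {η : ℝ → ℂ} {s M C : ℝ} (hs : 0 ≤ s) (hM : ∀ x, ‖η x‖ ≤ M)
    (hC : ∀ x : ℝ, 1 ≤ |x| → ‖η x‖ ≤ C * |x| ^ (-s)) :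
    ∃ C', 0 < C' ∧ ∀ x : ℝ, ‖η x‖ ≤ C' * (1 + |x|) ^ (-s) := by
  have hM0 : 0 ≤ M := (norm_nonneg _).trans (hM 0)
  have hC0 : 0 ≤ C := by simpa using (norm_nonneg _).trans (hC 1 (by simp))
  -- The factor `2^s` replaces `1 + |x|` by `(1 + |x|)/2`, which is at most `|x|` when `|x| ≥ 1` and
  -- at most `1` when `|x| ≤ 1`.
  refine ⟨(M + C + 1) * 2 ^ s, by positivity, fun x => ?_⟩
  have hp : 0 < 1 + |x| := by positivity
  have h2 : (2 : ℝ) ^ s * (1 + |x|) ^ (-s) = ((1 + |x|) / 2) ^ (-s) := by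
    rw [Real.div_rpow hp.le zero_le_two, Real.rpow_neg zero_le_two, div_inv_eq_mul, mul_comm]
  rw [mul_assoc, h2]
  rcases le_total 1 |x| with h | h
  · refine (hC x h).trans ?_
    have : |x| ^ (-s) ≤ ((1 + |x|) / 2) ^ (-s) :=
      Real.rpow_le_rpow_of_nonpos (by positivity) (by linarith) (by linarith)
    nlinarith [Real.rpow_nonneg (abs_nonneg x) (-s)]
  · refine (hM x).trans ?_
    have : 1 ≤ ((1 + |x|) / 2) ^ (-s) :=
      Real.one_le_rpow_of_pos_of_le_one_of_nonpos (by positivity) (by linarith) (by linarith)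
    nlinarith

/-- Integrability of the symbol bounds the profile everywhere; for `|x| ≥ 1` the two half-lines
decay separately, at the rate set by the behaviour `|ω|^(k-γ)` at the origin. -/
theorem norm_profile_le (a b : ℂ) {γ : ℂ} {k : ℕ} (hk : -1 < (k : ℝ) - γ.re)
    (D : SchwartzMap ℝ ℂ) :
    ∃ C, 0 < C ∧ ∀ x : ℝ, ‖profile a b γ k D x‖ ≤ C * (1 + |x|) ^ (-((k : ℝ) + 1 - γ.re)) := by
  have hre : ((k : ℂ) - γ).re = (k : ℝ) - γ.re := by simp
  obtain ⟨C₁, hC₁, h₁⟩ := norm_integral_oneSided_le (β := (k : ℂ) - γ) (by rwa [hre]) D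
  obtain ⟨C₂, hC₂, h₂⟩ := norm_integral_oneSided_le (β := (k : ℂ) - γ) (by rwa [hre])
    (schwartzReflect D)
  refine exists_norm_le_one_add_rpow (C := ‖1 / b‖ * C₁ + ‖(-1) ^ k / a‖ * C₂) (by linarith)
    (norm_fourierInv_le _) fun x hx => ?_
  rw [profile_eq a b hk, norm_mul]
  refine (mul_le_of_le_one_left (norm_nonneg _) norm_one_div_two_pi_le).trans ?_
  refine (norm_add_le _ _).trans ?_
  rw [norm_mul, norm_mul, add_mul, mul_assoc, mul_assoc,
    show -((k : ℝ) + 1 - γ.re) = -1 - ((k : ℂ) - γ).re by rw [hre]; ring]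
  gcongr
  · exact h₁ x hx
  · simpa using h₂ (-x) (by simpa using hx)

/-- The symbol stays integrable after multiplication by `|ω|`, and `|e^(iωx) - 1| ≤ |ω||x|`. This
serves the logarithmic asymptotics. -/
theorem norm_profile_sub_le (a b : ℂ) {γ : ℂ} {k : ℕ} (hk : -1 < (k : ℝ) - γ.re)
    (D : SchwartzMap ℝ ℂ) :
    ∃ C, 0 ≤ C ∧ ∀ x : ℝ, ‖profile a b γ k D x - profile a b γ k D 0‖ ≤ C * |x| := by
  have hi := integrable_mul_symbolRatio a b hk D
  set F := fun ω => D ω * symbolRatio a b γ k ω with hF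
  have hi' : Integrable fun ω : ℝ => |ω| * ‖F ω‖ := by
    refine ((integrable_rpow_mul_schwartz (p := (k : ℝ) - γ.re + 1) (by linarith) D).const_mul
      (‖1 / b‖ + ‖1 / a‖)).mono' ?_ (Eventually.of_forall fun ω => ?_)
    · exact (continuous_abs.aestronglyMeasurable).mul hi.1.norm
    · rw [norm_mul, norm_norm, Real.norm_eq_abs, abs_abs, hF, norm_mul]
      rcases eq_or_ne ω 0 with rfl | hω
      · simp only [abs_zero, zero_mul]; positivity
      · rw [Real.rpow_add_one (abs_pos.2 hω).ne']
        have := mul_le_mul_of_nonneg_left (norm_symbolRatio_le a b γ k ω)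
          (mul_nonneg (abs_nonneg ω) (norm_nonneg (D ω)))
        linarith
  refine ⟨∫ ω, |ω| * ‖F ω‖, integral_nonneg fun ω => by positivity, fun x => ?_⟩
  have e : profile a b γ k D x - profile a b γ k D 0 = 1 / (2 * (Real.pi : ℂ)) *
      ∫ ω : ℝ, F ω * (Complex.exp (Complex.I * ω * x) - 1) := by
    simp only [profile, fourierInv]
    rw [← mul_sub, ← integral_sub (integrable_mul_exp hi x) (integrable_mul_exp hi 0)]
    congr 1
    refine integral_congr_ae (Eventually.of_forall fun ω => ?_)
    simp [mul_sub]
  rw [e, norm_mul]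
  refine (mul_le_of_le_one_left (norm_nonneg _) norm_one_div_two_pi_le).trans ?_
  rw [← integral_mul_const]
  refine norm_integral_le_of_norm_le (hi'.mul_const _) (Eventually.of_forall fun ω => ?_)
  have h1 : ‖Complex.exp (Complex.I * ω * x) - 1‖ ≤ |ω| * |x| := by
    have := Real.norm_exp_I_mul_ofReal_sub_one_le (x := ω * x)
    rwa [Complex.ofReal_mul, ← mul_assoc, Real.norm_eq_abs, abs_mul] at this
  rw [norm_mul]
  have := mul_le_mul_of_nonneg_left h1 (norm_nonneg (F ω))
  linarith

/-! ### Weighted means of dilates -/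

/-- The weighted mean `(1/n!) ∫_0^1 (1-t)^n t^{-σ} η(x/t) dt` of the dilates of `η`. -/
def dilationMean (n : ℕ) (σ : ℂ) (η : ℝ → ℂ) (x : ℝ) : ℂ :=
  1 / (n.factorial : ℂ) *
    ∫ t in (0 : ℝ)..1, ((1 - t : ℝ) : ℂ) ^ n * ((t : ℂ) ^ (-σ) * η (x / t))

theorem norm_one_sub_pow_le (n : ℕ) {t : ℝ} (h0 : 0 ≤ t) (h1 : t ≤ 1) :
    ‖((1 - t : ℝ) : ℂ) ^ n‖ ≤ 1 := by
  rw [norm_pow, Complex.norm_real, Real.norm_eq_abs]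
  exact pow_le_one₀ (abs_nonneg _) (abs_le.2 ⟨by linarith, by linarith⟩)

theorem norm_one_div_factorial_le (n : ℕ) : ‖(1 / (n.factorial : ℂ))‖ ≤ 1 := by
  rw [norm_div, norm_one, Complex.norm_natCast]
  exact div_le_one_of_le₀ (by exact_mod_cast n.factorial_pos) (by positivity)

/-- The decay of `η` exactly compensates the weight: `t^(-s) (1+|x|/t)^(-s) = (t+|x|)^(-s)`, which
is not singular at `t = 0` for `x ≠ 0`. -/
theorem norm_dilation_le {σ : ℂ} {η : ℝ → ℂ} {C : ℝ}
    (hη : ∀ x : ℝ, ‖η x‖ ≤ C * (1 + |x|) ^ (-σ.re)) {t : ℝ} (ht : 0 < t) (x : ℝ) :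
    ‖(t : ℂ) ^ (-σ) * η (x / t)‖ ≤ C * (t + |x|) ^ (-σ.re) := by
  rw [norm_mul, Complex.norm_cpow_eq_rpow_re_of_pos ht, Complex.neg_re]
  calc t ^ (-σ.re) * ‖η (x / t)‖ ≤ t ^ (-σ.re) * (C * (1 + |x / t|) ^ (-σ.re)) := by
        gcongr; exact hη _
    _ = C * (t ^ (-σ.re) * (1 + |x / t|) ^ (-σ.re)) := by ring
    _ = C * (t + |x|) ^ (-σ.re) := by
        rw [← Real.mul_rpow ht.le (by positivity), abs_div, abs_of_pos ht, mul_add, mul_one,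
          mul_div_cancel₀ _ ht.ne']

theorem norm_dilationMean_integrand_le (n : ℕ) {σ : ℂ} {η : ℝ → ℂ} {C : ℝ}
    (hη : ∀ x : ℝ, ‖η x‖ ≤ C * (1 + |x|) ^ (-σ.re)) {t : ℝ} (h0 : 0 < t) (h1 : t ≤ 1) (x : ℝ) :
    ‖((1 - t : ℝ) : ℂ) ^ n * ((t : ℂ) ^ (-σ) * η (x / t))‖ ≤ C * (t + |x|) ^ (-σ.re) := by
  rw [norm_mul]
  exact (mul_le_of_le_one_left (norm_nonneg _) (norm_one_sub_pow_le n h0.le h1)).trans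
    (norm_dilation_le hη h0 x)

theorem measurable_dilationMean_integrand (n : ℕ) (σ : ℂ) {η : ℝ → ℂ} (hc : Continuous η) :
    Measurable fun p : ℝ × ℝ =>
      ((1 - p.1 : ℝ) : ℂ) ^ n * ((p.1 : ℂ) ^ (-σ) * η (p.2 / p.1)) := by
  have h1 : Measurable fun p : ℝ × ℝ => η (p.2 / p.1) :=
    hc.measurable.comp (measurable_snd.div measurable_fst)
  fun_prop

theorem intervalIntegrable_add_rpow {x : ℝ} (hx : x ≠ 0) (s : ℝ) :
    IntervalIntegrable (fun t : ℝ => (t + |x|) ^ s) volume 0 1 := by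
  have hx' := abs_pos.2 hx
  refine ContinuousOn.intervalIntegrable fun t ht => ?_
  rw [uIcc_of_le zero_le_one] at ht
  exact (ContinuousAt.rpow_const (by fun_prop)
    (Or.inl (by linarith [ht.1]))).continuousWithinAt

theorem norm_dilationMean_le (n : ℕ) {σ : ℂ} {η : ℝ → ℂ} {C : ℝ}
    (hη : ∀ x : ℝ, ‖η x‖ ≤ C * (1 + |x|) ^ (-σ.re)) {x : ℝ} (hx : x ≠ 0) :
    ‖dilationMean n σ η x‖ ≤ C * ∫ t in (0 : ℝ)..1, (t + |x|) ^ (-σ.re) := by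
  rw [dilationMean, norm_mul, ← intervalIntegral.integral_const_mul]
  refine (mul_le_of_le_one_left (norm_nonneg _) (norm_one_div_factorial_le n)).trans ?_
  exact intervalIntegral.norm_integral_le_of_norm_le zero_le_one
    (Eventually.of_forall fun t ht => norm_dilationMean_integrand_le n hη ht.1 ht.2 x)
    ((intervalIntegrable_add_rpow hx _).const_mul C)

theorem continuousOn_dilationMean (n : ℕ) {σ : ℂ} (hσ : 0 ≤ σ.re) {η : ℝ → ℂ}
    (hc : Continuous η) {C : ℝ} (hC : 0 ≤ C)
    (hη : ∀ x : ℝ, ‖η x‖ ≤ C * (1 + |x|) ^ (-σ.re)) :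
    ContinuousOn (dilationMean n σ η) {0}ᶜ := by
  intro x₀ hx₀
  have hx₀' : 0 < |x₀| := abs_pos.2 hx₀
  refine ContinuousAt.continuousWithinAt (ContinuousAt.mul continuousAt_const
    (intervalIntegral.continuousAt_of_dominated_interval
      (bound := fun _ => C * (|x₀| / 2) ^ (-σ.re)) ?_ ?_ (by simp) ?_))
  · exact Eventually.of_forall fun x =>
      ((measurable_dilationMean_integrand n σ hc).comp
        (measurable_id.prodMk measurable_const)).aestronglyMeasurable
  · have hnear : ∀ᶠ x : ℝ in 𝓝 x₀, |x₀| / 2 < |x| :=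
      continuous_abs.continuousAt.eventually (lt_mem_nhds (by linarith))
    filter_upwards [hnear] with x hx
    refine Eventually.of_forall fun t ht => ?_
    rw [uIoc_of_le zero_le_one] at ht
    refine (norm_dilationMean_integrand_le n hη ht.1 ht.2 x).trans ?_
    refine mul_le_mul_of_nonneg_left ?_ hC
    exact Real.rpow_le_rpow_of_nonpos (by positivity) (by linarith [ht.1]) (by linarith)
  · exact Eventually.of_forall fun t _ => by fun_prop

/-- A majorant with separated variables gives joint integrability for Fubini. Leaving `A` and `B`
free covers both kinds of test function: supported away from `0`, or arbitrary with `Re σ < 2`. -/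
theorem integrable_dilationMean_kernel (n : ℕ) {σ : ℂ} {η : ℝ → ℂ} (hc : Continuous η) {C : ℝ}
    (hC : 0 ≤ C) (hη : ∀ x : ℝ, ‖η x‖ ≤ C * (1 + |x|) ^ (-σ.re)) {ψ : ℝ → ℂ} (hψ : Continuous ψ)
    {A B : ℝ → ℝ} (hA : IntegrableOn A (Ioc 0 1)) (hB : Integrable B)
    (hAB : ∀ t ∈ Ioc (0 : ℝ) 1, ∀ x : ℝ, x ≠ 0 → (t + |x|) ^ (-σ.re) * ‖ψ x‖ ≤ A t * B x) :
    Integrable (fun p : ℝ × ℝ =>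
      ((1 - p.1 : ℝ) : ℂ) ^ n * ((p.1 : ℂ) ^ (-σ) * η (p.2 / p.1)) * ψ p.2)
      ((volume.restrict (Ioc 0 1)).prod volume) := by
  refine ((hA.mul_prod hB).const_mul C).mono'
    ((measurable_dilationMean_integrand n σ hc).mul
      (hψ.measurable.comp measurable_snd)).aestronglyMeasurable ?_
  have h1 : ∀ᵐ p : ℝ × ℝ ∂((volume.restrict (Ioc 0 1)).prod volume), p.1 ∈ Ioc (0 : ℝ) 1 :=
    Measure.quasiMeasurePreserving_fst.ae (ae_restrict_mem measurableSet_Ioc)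
  have h2 : ∀ᵐ p : ℝ × ℝ ∂((volume.restrict (Ioc 0 1)).prod volume), p.2 ≠ 0 :=
    Measure.quasiMeasurePreserving_snd.ae (Measure.ae_ne volume 0)
  filter_upwards [h1, h2] with p hp1 hp2
  rw [norm_mul]
  calc _ ≤ C * (p.1 + |p.2|) ^ (-σ.re) * ‖ψ p.2‖ := by
        gcongr
        exact norm_dilationMean_integrand_le n hη hp1.1 hp1.2 p.2
    _ = C * ((p.1 + |p.2|) ^ (-σ.re) * ‖ψ p.2‖) := by ring
    _ ≤ C * (A p.1 * B p.2) := mul_le_mul_of_nonneg_left (hAB p.1 hp1 p.2 hp2) hC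

theorem integral_dilationMean_mul (n : ℕ) {σ : ℂ} {η ψ : ℝ → ℂ}
    (hint : Integrable (fun p : ℝ × ℝ =>
      ((1 - p.1 : ℝ) : ℂ) ^ n * ((p.1 : ℂ) ^ (-σ) * η (p.2 / p.1)) * ψ p.2)
      ((volume.restrict (Ioc 0 1)).prod volume)) :
    Integrable (fun x => dilationMean n σ η x * ψ x) ∧
      ∫ x, dilationMean n σ η x * ψ x = 1 / (n.factorial : ℂ) *
        ∫ t in (0 : ℝ)..1, ((1 - t : ℝ) : ℂ) ^ n * ∫ x, (t : ℂ) ^ (-σ) * η (x / t) * ψ x := by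
  have e : ∀ x, dilationMean n σ η x * ψ x = 1 / (n.factorial : ℂ) *
      ∫ t in Ioc (0 : ℝ) 1, ((1 - t : ℝ) : ℂ) ^ n * ((t : ℂ) ^ (-σ) * η (x / t)) * ψ x :=
    fun x => by
      rw [dilationMean, intervalIntegral.integral_of_le zero_le_one, mul_assoc,
        ← integral_mul_const]
  simp_rw [e]
  refine ⟨hint.integral_prod_right.const_mul _, ?_⟩
  rw [integral_const_mul, ← integral_integral_swap hint,
    intervalIntegral.integral_of_le zero_le_one]
  simp_rw [mul_assoc, integral_const_mul]

/-- The inverse Fourier transform is symmetric for the bilinear pairing. -/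
theorem integral_mul_fourierInv {f g : ℝ → ℂ} (hf : Integrable f) (hg : Integrable g) :
    ∫ ω, f ω * fourierInv g ω = ∫ x, fourierInv f x * g x := by
  have hint : Integrable (fun p : ℝ × ℝ => f p.1 * g p.2 * Complex.exp (Complex.I * p.1 * p.2))
      (volume.prod volume) := by
    refine (hf.mul_prod hg).norm.mono'
      ((hf.mul_prod hg).1.mul (Continuous.aestronglyMeasurable (by fun_prop)))
      (Eventually.of_forall fun p => ?_)
    rw [norm_mul, norm_exp_I_mul, mul_one]
  have e1 : ∀ ω, f ω * fourierInv g ω = 1 / (2 * (Real.pi : ℂ)) *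
      ∫ x : ℝ, f ω * g x * Complex.exp (Complex.I * ω * x) := fun ω => by
    simp_rw [mul_assoc (f ω), integral_const_mul, fourierInv]
    rw [mul_left_comm]
    congr 3
    ext x
    ring_nf
  have e2 : ∀ x, fourierInv f x * g x = 1 / (2 * (Real.pi : ℂ)) *
      ∫ ω : ℝ, f ω * g x * Complex.exp (Complex.I * ω * x) := fun x => by
    rw [fourierInv, mul_assoc, ← integral_mul_const]
    congr 2
    ext ω
    ring
  simp_rw [e1, e2, integral_const_mul]
  rw [integral_integral_swap hint]

/-- Substituting `u = tω`, the Jacobian `t⁻¹` and the homogeneity factor `t^(-(k-γ))` combine to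
`t^(-σ)`. -/
theorem fourierInv_dilate (a b γ : ℂ) (k : ℕ) (D : SchwartzMap ℝ ℂ) {t : ℝ} (ht : 0 < t) (x : ℝ) :
    fourierInv (fun ω => D (t * ω) * symbolRatio a b γ k ω) x =
      (t : ℂ) ^ (-((k : ℂ) + 1 - γ)) * profile a b γ k D (x / t) := by
  have ht0 : (t : ℂ) ≠ 0 := by exact_mod_cast ht.ne'
  have h := Measure.integral_comp_mul_left (fun u : ℝ => D u * symbolRatio a b γ k u *
    Complex.exp (Complex.I * u * (x / t : ℝ))) t
  rw [abs_of_pos (inv_pos.2 ht), Complex.real_smul] at h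
  have e : ∀ ω : ℝ, D (t * ω) * symbolRatio a b γ k ω * Complex.exp (Complex.I * ω * x) =
      (t : ℂ) ^ (-((k : ℂ) - γ)) * (D (t * ω) * symbolRatio a b γ k (t * ω) *
        Complex.exp (Complex.I * (t * ω : ℝ) * (x / t : ℝ))) := fun ω => by
    rw [symbolRatio_mul a b γ k ht, Complex.cpow_neg]
    have hne : (t : ℂ) ^ ((k : ℂ) - γ) ≠ 0 := by simp [Complex.cpow_eq_zero_iff, ht0]
    have : Complex.I * (t * ω : ℝ) * (x / t : ℝ) = Complex.I * ω * x := by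
      push_cast; field_simp
    rw [this]
    field_simp
  simp only [profile, fourierInv]
  simp_rw [e, integral_const_mul, h]
  rw [show -((k : ℂ) + 1 - γ) = -((k : ℂ) - γ) + (-1) by ring, Complex.cpow_add _ _ ht0,
    Complex.cpow_neg_one]
  push_cast
  ring

/-! ### The symbol as a mean of dilates; representation by a function -/

/-- The `k`-th derivative of the Fourier transform of `φ`. -/
abbrev fourierDeriv (k : ℕ) (φ : SchwartzMap ℝ ℂ) : SchwartzMap ℝ ℂ :=
  schwartzDeriv k (schwartzFourier φ)

theorem adjSymbol_eq (a b γ : ℂ) (n : ℕ) (φ : SchwartzMap ℝ ℂ) (ω : ℝ) :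
    adjSymbol a b γ (n + 1) φ ω = 1 / (n.factorial : ℂ) *
      ∫ t in (0 : ℝ)..1, ((1 - t : ℝ) : ℂ) ^ n *
        (fourierDeriv (n + 1) φ (t * ω) * symbolRatio a b γ (n + 1) ω) := by
  have h := taylor_remainder_eq n (schwartzFourier φ) ω
  rw [coe_schwartzFourier] at h
  rw [adjSymbol, h]
  simp_rw [← mul_assoc, intervalIntegral.integral_mul_const, symbolRatio]
  ring

theorem exists_norm_adjSymbol_le (a b γ : ℂ) (n : ℕ) (φ : SchwartzMap ℝ ℂ) :
    ∃ C, 0 < C ∧ ∀ ω : ℝ,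
      ‖adjSymbol a b γ (n + 1) φ ω‖ ≤ C * |ω| ^ (((n + 1 : ℕ) : ℝ) - γ.re) := by
  obtain ⟨M, hM, h⟩ := (fourierDeriv (n + 1) φ).decay 0 0
  simp only [pow_zero, one_mul, norm_iteratedFDeriv_zero] at h
  -- The `+ 1` keeps the constant positive: `a` and `b` may vanish here, with `1 / 0 = 0`.
  refine ⟨M * (‖1 / b‖ + ‖1 / a‖) + 1, by positivity, fun ω => ?_⟩
  rw [adjSymbol_eq, norm_mul]
  refine (mul_le_of_le_one_left (norm_nonneg _) (norm_one_div_factorial_le n)).trans ?_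
  have hb : ∀ t ∈ uIoc (0 : ℝ) 1, ‖((1 - t : ℝ) : ℂ) ^ n *
      (fourierDeriv (n + 1) φ (t * ω) * symbolRatio a b γ (n + 1) ω)‖ ≤
      M * ((‖1 / b‖ + ‖1 / a‖) * |ω| ^ (((n + 1 : ℕ) : ℝ) - γ.re)) := fun t ht => by
    rw [uIoc_of_le zero_le_one] at ht
    rw [norm_mul, norm_mul]
    refine (mul_le_of_le_one_left (by positivity)
      (norm_one_sub_pow_le n ht.1.le ht.2)).trans ?_
    gcongr
    · exact h _
    · exact norm_symbolRatio_le a b γ (n + 1) ω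
  refine (intervalIntegral.norm_integral_le_of_norm_le_const hb).trans ?_
  have : 0 ≤ |ω| ^ (((n + 1 : ℕ) : ℝ) - γ.re) := by positivity
  simp only [sub_zero, abs_one, mul_one]
  nlinarith

theorem measurable_adjSymbol (a b γ : ℂ) (k : ℕ) (φ : SchwartzMap ℝ ℂ) :
    Measurable (adjSymbol a b γ k φ) := by
  have h1 : Measurable fun ω : ℝ => homMultiplier a b γ (-ω) :=
    (measurable_homMultiplier a b γ).comp measurable_neg
  have h2 : Measurable (fourier φ) := by
    rw [← coe_schwartzFourier]; exact (schwartzFourier φ).continuous.measurable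
  unfold adjSymbol
  fun_prop

theorem integrable_adjSymbol_mul (a b : ℂ) {γ : ℂ} {n : ℕ}
    (hk : -1 < ((n + 1 : ℕ) : ℝ) - γ.re) (φ θ : SchwartzMap ℝ ℂ) :
    Integrable fun ω : ℝ => adjSymbol a b γ (n + 1) φ ω * θ ω := by
  obtain ⟨C, -, h⟩ := exists_norm_adjSymbol_le a b γ n φ
  refine ((integrable_rpow_mul_schwartz hk θ).const_mul C).mono'
    ((measurable_adjSymbol a b γ (n + 1) φ).mul θ.continuous.measurable).aestronglyMeasurable
    (Eventually.of_forall fun ω => ?_)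
  rw [norm_mul, ← mul_assoc]
  gcongr
  exact h ω

theorem integral_adjSymbol_mul (a b : ℂ) {γ : ℂ} {n : ℕ}
    (hk : -1 < ((n + 1 : ℕ) : ℝ) - γ.re) (φ θ : SchwartzMap ℝ ℂ) :
    ∫ ω, adjSymbol a b γ (n + 1) φ ω * θ ω = 1 / (n.factorial : ℂ) *
      ∫ t in (0 : ℝ)..1, ((1 - t : ℝ) : ℂ) ^ n *
        ∫ ω, fourierDeriv (n + 1) φ (t * ω) * symbolRatio a b γ (n + 1) ω * θ ω := by
  obtain ⟨M, hM, h⟩ := (fourierDeriv (n + 1) φ).decay 0 0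
  simp only [pow_zero, one_mul, norm_iteratedFDeriv_zero] at h
  have hθ := integrable_mul_symbolRatio a b hk θ
  have hint : Integrable (fun p : ℝ × ℝ => ((1 - p.2 : ℝ) : ℂ) ^ n *
      (fourierDeriv (n + 1) φ (p.2 * p.1) * symbolRatio a b γ (n + 1) p.1) * θ p.1)
      (volume.prod (volume.restrict (Ioc 0 1))) := by
    have hone : Integrable (fun _ : ℝ => M) (volume.restrict (Ioc (0 : ℝ) 1)) :=
      integrable_const _
    refine (hθ.norm.mul_prod hone).mono' ?_ ?_
    · have h1 : Measurable fun p : ℝ × ℝ => symbolRatio a b γ (n + 1) p.1 :=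
        (measurable_symbolRatio a b γ (n + 1)).comp measurable_fst
      have h2 : Measurable fun p : ℝ × ℝ => fourierDeriv (n + 1) φ (p.2 * p.1) :=
        (fourierDeriv (n + 1) φ).continuous.measurable.comp (by fun_prop)
      have h3 : Measurable fun p : ℝ × ℝ => θ p.1 := θ.continuous.measurable.comp measurable_fst
      exact Measurable.aestronglyMeasurable (by fun_prop)
    · have h1 : ∀ᵐ p : ℝ × ℝ ∂(volume.prod (volume.restrict (Ioc 0 1))), p.2 ∈ Ioc (0 : ℝ) 1 :=
        Measure.quasiMeasurePreserving_snd.ae (ae_restrict_mem measurableSet_Ioc)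
      filter_upwards [h1] with p hp
      have e : ((1 - p.2 : ℝ) : ℂ) ^ n *
          (fourierDeriv (n + 1) φ (p.2 * p.1) * symbolRatio a b γ (n + 1) p.1) * θ p.1 =
          ((1 - p.2 : ℝ) : ℂ) ^ n * ((θ p.1 * symbolRatio a b γ (n + 1) p.1) *
            fourierDeriv (n + 1) φ (p.2 * p.1)) := by ring
      rw [e, norm_mul, norm_mul (θ p.1 * _)]
      refine (mul_le_of_le_one_left (by positivity)
        (norm_one_sub_pow_le n hp.1.le hp.2)).trans ?_
      gcongr
      exact h _
  have e : ∀ ω, adjSymbol a b γ (n + 1) φ ω * θ ω = 1 / (n.factorial : ℂ) *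
      ∫ t in Ioc (0 : ℝ) 1, ((1 - t : ℝ) : ℂ) ^ n *
        (fourierDeriv (n + 1) φ (t * ω) * symbolRatio a b γ (n + 1) ω) * θ ω := fun ω => by
    rw [adjSymbol_eq, intervalIntegral.integral_of_le zero_le_one, mul_assoc,
      ← integral_mul_const]
  simp_rw [e]
  rw [integral_const_mul, integral_integral_swap hint,
    intervalIntegral.integral_of_le zero_le_one]
  simp_rw [mul_assoc, integral_const_mul]

/-- The function representing the adjoint integrator away from the origin. -/
def integratorFun (a b γ : ℂ) (n : ℕ) (φ : SchwartzMap ℝ ℂ) : ℝ → ℂ :=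
  dilationMean n (((n + 1 : ℕ) : ℂ) + 1 - γ) (profile a b γ (n + 1) (fourierDeriv (n + 1) φ))

theorem re_exponent (γ : ℂ) (k : ℕ) : ((k : ℂ) + 1 - γ).re = (k : ℝ) + 1 - γ.re := by simp

/-- Both sides are means over `t`, so it suffices to compare them for fixed `t > 0`. There `D(tω)
r(ω)` is integrable, and the inverse transform can be moved onto it from `ψ`. -/
theorem representedAt_of_kernel_bound (a b : ℂ) {γ : ℂ} {n : ℕ}
    (hk : -1 < ((n + 1 : ℕ) : ℝ) - γ.re) (φ ψ : SchwartzMap ℝ ℂ)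
    {A B : ℝ → ℝ} (hA : IntegrableOn A (Ioc 0 1)) (hB : Integrable B)
    (hAB : ∀ t ∈ Ioc (0 : ℝ) 1, ∀ x : ℝ, x ≠ 0 →
      (t + |x|) ^ (-(((n + 1 : ℕ) : ℝ) + 1 - γ.re)) * ‖ψ x‖ ≤ A t * B x) :
    RepresentedAt (adjIntegrator a b γ (n + 1) φ) (integratorFun a b γ n φ) ψ := by
  obtain ⟨C, hC, h⟩ := norm_profile_le a b hk (fourierDeriv (n + 1) φ)
  rw [← re_exponent] at h
  rw [← re_exponent] at hAB
  have hint := integrable_dilationMean_kernel n (continuous_profile a b hk _) hC.le h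
    ψ.continuous hA hB hAB
  obtain ⟨h1, h2⟩ := integral_dilationMean_mul n hint
  refine ⟨h1, ?_⟩
  simp only [integratorFun]
  rw [h2, adjIntegrator, ← coe_schwartzFourierInv, integral_adjSymbol_mul a b hk]
  congr 1
  refine intervalIntegral.integral_congr_ae (Eventually.of_forall fun t ht => ?_)
  rw [uIoc_of_le zero_le_one] at ht
  have hD : Integrable fun ω => fourierDeriv (n + 1) φ (t * ω) * symbolRatio a b γ (n + 1) ω :=
    integrable_mul_symbolRatio a b hk
      (SchwartzMap.compCLMOfContinuousLinearEquiv ℂ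
        (ContinuousLinearEquiv.smulLeft (R₁ := ℝ) (M₁ := ℝ) (Units.mk0 t ht.1.ne'))
        (fourierDeriv (n + 1) φ))
  rw [coe_schwartzFourierInv, integral_mul_fourierInv hD ψ.integrable]
  simp_rw [fourierInv_dilate a b γ (n + 1) _ ht.1]

/-- Halving the exponent, `(t+|x|)^(-s) ≤ t^(-s/2) |x|^(-s/2)`; both factors are locally integrable
because `s < 2`. -/
theorem representedAt_of_lt_one (a b : ℂ) {γ : ℂ} {n : ℕ}
    (hk : -1 < ((n + 1 : ℕ) : ℝ) - γ.re) (hk1 : ((n + 1 : ℕ) : ℝ) - γ.re < 1)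
    (φ ψ : SchwartzMap ℝ ℂ) :
    RepresentedAt (adjIntegrator a b γ (n + 1) φ) (integratorFun a b γ n φ) ψ := by
  set s := ((n + 1 : ℕ) : ℝ) + 1 - γ.re with hs
  have hA := (intervalIntegral.intervalIntegrable_rpow' (a := 0) (b := 1)
    (show -1 < -(s / 2) by linarith)).1
  refine representedAt_of_kernel_bound a b hk φ ψ hA
    (integrable_rpow_mul_schwartz (show -1 < -(s / 2) by linarith) ψ) fun t ht x hx => ?_
  have hx' := abs_pos.2 hx
  rw [← hs, ← mul_assoc]
  gcongr
  have h1 : (t + |x|) ^ (-s) = (t + |x|) ^ (-(s / 2)) * (t + |x|) ^ (-(s / 2)) := by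
    rw [← Real.rpow_add (by linarith [ht.1])]; ring_nf
  rw [h1]
  have h2 : (t + |x|) ^ (-(s / 2)) ≤ t ^ (-(s / 2)) :=
    Real.rpow_le_rpow_of_nonpos ht.1 (by linarith) (by linarith)
  have h3 : (t + |x|) ^ (-(s / 2)) ≤ |x| ^ (-(s / 2)) :=
    Real.rpow_le_rpow_of_nonpos hx' (by linarith [ht.1]) (by linarith)
  exact mul_le_mul h2 h3 (Real.rpow_nonneg (by linarith [ht.1]) _) (Real.rpow_nonneg ht.1.le _)

theorem representedAt_of_notMem_tsupport (a b : ℂ) {γ : ℂ} {n : ℕ}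
    (hk : -1 < ((n + 1 : ℕ) : ℝ) - γ.re) (φ ψ : SchwartzMap ℝ ℂ) (h0 : (0 : ℝ) ∉ tsupport ψ) :
    RepresentedAt (adjIntegrator a b γ (n + 1) φ) (integratorFun a b γ n φ) ψ := by
  set s := ((n + 1 : ℕ) : ℝ) + 1 - γ.re with hs
  obtain ⟨δ, hδ, hball⟩ := Metric.eventually_nhds_iff.1 (notMem_tsupport_iff_eventuallyEq.1 h0)
  refine representedAt_of_kernel_bound a b hk φ ψ (A := fun _ => δ ^ (-s))
    (B := fun x => ‖ψ x‖) (integrable_const _) ψ.integrable.norm fun t ht x hx => ?_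
  rcases lt_or_ge |x| δ with h | h
  · have : ψ x = 0 := hball (by simpa using h)
    simp [this]
  · exact mul_le_mul_of_nonneg_right
      (Real.rpow_le_rpow_of_nonpos hδ (by linarith [ht.1]) (by linarith)) (norm_nonneg _)

/-! ### Membership in `L_p` from power bounds; the elementary kernel integrals -/

theorem integrableOn_Ioi_of_rpow_bounds {F : ℝ → ℝ} (hF : AEStronglyMeasurable F volume)
    {C u v : ℝ} (hu : u < 1) (hv : 1 < v)
    (h0 : ∀ x, 0 < x → x ≤ 1 → ‖F x‖ ≤ C * x ^ (-u))
    (h1 : ∀ x, 1 ≤ x → ‖F x‖ ≤ C * x ^ (-v)) : IntegrableOn F (Ioi 0) := by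
  rw [← Ioc_union_Ioi_eq_Ioi zero_le_one]
  refine IntegrableOn.union ?_ ?_
  · refine Integrable.mono' ((intervalIntegral.intervalIntegrable_rpow' (a := 0) (b := 1)
      (neg_lt_neg hu)).1.const_mul C) hF.restrict ?_
    exact (ae_restrict_iff' measurableSet_Ioc).2
      (Eventually.of_forall fun x hx => h0 x hx.1 hx.2)
  · refine Integrable.mono' ((integrableOn_Ioi_rpow_of_lt (neg_lt_neg hv) one_pos).const_mul C)
      hF.restrict ?_
    exact (ae_restrict_iff' measurableSet_Ioi).2 (Eventually.of_forall fun x hx => h1 x hx.le)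

theorem aestronglyMeasurable_of_continuousOn_compl_zero {g : ℝ → ℂ} (hg : ContinuousOn g {0}ᶜ) :
    AEStronglyMeasurable g volume := by
  have h := hg.aestronglyMeasurable (μ := volume) (measurableSet_singleton 0).compl
  have hae : ∀ᵐ x : ℝ, x ∈ ({0}ᶜ : Set ℝ) := Measure.ae_ne volume 0
  rwa [Measure.restrict_eq_self_of_ae_mem hae] at h

/-- A criterion for `g ∈ L_p` in terms of power bounds at the origin and at infinity. -/
theorem memLp_of_rpow_bounds {g : ℝ → ℂ} (hg : ContinuousOn g {0}ᶜ) {C u v p : ℝ} (hp : 0 < p)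
    (hu : u * p < 1) (hv : 1 < v * p)
    (h0 : ∀ x : ℝ, x ≠ 0 → |x| ≤ 1 → ‖g x‖ ≤ C * |x| ^ (-u))
    (h1 : ∀ x : ℝ, 1 ≤ |x| → ‖g x‖ ≤ C * |x| ^ (-v)) : MemLp g (ENNReal.ofReal p) volume := by
  have hm := aestronglyMeasurable_of_continuousOn_compl_zero hg
  have hC : 0 ≤ C := by simpa using (norm_nonneg _).trans (h1 1 (by simp))
  rw [← integrable_norm_rpow_iff hm (by simpa using hp) (by simp), ENNReal.toReal_ofReal hp.le]
  -- Applied with `q` the identity and the reflection, to treat both half-lines at once.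
  have key : ∀ q : ℝ → ℝ, (∀ x, |q x| = |x|) → AEStronglyMeasurable (fun x => g (q x)) volume →
      IntegrableOn (fun x => ‖g (q x)‖ ^ p) (Ioi 0) := fun q hq hmq => by
    refine integrableOn_Ioi_of_rpow_bounds (C := C ^ p) (u := u * p) (v := v * p)
      (hmq.norm.aemeasurable.pow_const p).aestronglyMeasurable hu hv (fun x hx hx1 => ?_)
      (fun x hx => ?_)
    all_goals
      have hx0 : 0 < x := by linarith
      rw [Real.norm_of_nonneg (by positivity), ← neg_mul, Real.rpow_mul hx0.le,
        ← Real.mul_rpow hC (by positivity)]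
      refine Real.rpow_le_rpow (norm_nonneg _) ?_ hp.le
    · have := h0 (q x) (abs_pos.1 (by rw [hq]; positivity)) (by rwa [hq, abs_of_pos hx0])
      rwa [hq, abs_of_pos hx0] at this
    · have := h1 (q x) (by rwa [hq, abs_of_pos hx0])
      rwa [hq, abs_of_pos hx0] at this
  exact integrable_of_Ioi_of_comp_neg (key id (fun _ => rfl) hm)
    (key Neg.neg abs_neg (hm.comp_quasiMeasurePreserving
      (Measure.measurePreserving_neg volume).quasiMeasurePreserving))

theorem integral_add_rpow_le_of_le {s : ℝ} (hs : 0 ≤ s) {x : ℝ} (hx : x ≠ 0) :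
    ∫ t in (0 : ℝ)..1, (t + |x|) ^ (-s) ≤ |x| ^ (-s) := by
  have h := intervalIntegral.integral_mono_on zero_le_one (intervalIntegrable_add_rpow hx (-s))
    (intervalIntegrable_const (c := |x| ^ (-s))) fun t ht =>
      Real.rpow_le_rpow_of_nonpos (abs_pos.2 hx) (by linarith [ht.1]) (by linarith)
  simpa using h

/-- Split `(t+|x|)^(-s) ≤ |x|^(-α) t^(-(s-α))`. Taking `α = 0` gives boundedness when `s < 1`; a
small `α > 0` replaces the logarithm when `s = 1`. -/
theorem integral_add_rpow_le {s α : ℝ} (hα : 0 ≤ α) (hαs : α ≤ s) (hs : s - α < 1) {x : ℝ}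
    (hx : x ≠ 0) :
    ∫ t in (0 : ℝ)..1, (t + |x|) ^ (-s) ≤ 1 / (1 - (s - α)) * |x| ^ (-α) := by
  have hx' := abs_pos.2 hx
  have hi := (intervalIntegral.intervalIntegrable_rpow' (a := 0) (b := 1)
    (show -1 < -(s - α) by linarith)).const_mul (|x| ^ (-α))
  have h := intervalIntegral.integral_mono_on_of_le_Ioo zero_le_one
    (intervalIntegrable_add_rpow hx (-s)) hi fun t ht => by
      have e : (t + |x|) ^ (-s) = (t + |x|) ^ (-α) * (t + |x|) ^ (-(s - α)) := by
        rw [← Real.rpow_add (by linarith [ht.1])]; ring_nf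
      rw [e]
      exact mul_le_mul (Real.rpow_le_rpow_of_nonpos hx' (by linarith [ht.1]) (by linarith))
        (Real.rpow_le_rpow_of_nonpos ht.1 (by linarith) (by linarith))
        (Real.rpow_nonneg (by linarith [ht.1]) _) (by positivity)
  refine h.trans (le_of_eq ?_)
  rw [intervalIntegral.integral_const_mul, integral_rpow (Or.inl (by linarith)),
    Real.zero_rpow (by linarith), Real.one_rpow]
  ring

theorem integral_add_eq (f : ℝ → ℝ) (c x : ℝ) :
    ∫ t in (0 : ℝ)..c, f (t + |x|) = ∫ t in |x|..(c + |x|), f t := by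
  rw [intervalIntegral.integral_comp_add_right, zero_add]

theorem integral_add_rpow_le_of_one_lt {s : ℝ} (hs : 1 < s) {x : ℝ} (hx : x ≠ 0) :
    ∫ t in (0 : ℝ)..1, (t + |x|) ^ (-s) ≤ 1 / (s - 1) * |x| ^ (1 - s) := by
  have hx' := abs_pos.2 hx
  rw [integral_add_eq (fun t => t ^ (-s)) 1 x, integral_rpow]
  · have h1 : 0 ≤ (1 + |x|) ^ (-s + 1) := by positivity
    rw [show -s + 1 = -(s - 1) by ring] at h1 ⊢
    rw [div_neg, ← neg_div, neg_sub, show 1 - s = -(s - 1) by ring, one_div_mul_eq_div]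
    gcongr
    linarith
  · right
    refine ⟨by linarith, ?_⟩
    rw [uIcc_of_le (by linarith)]
    exact fun h => absurd h.1 (by linarith)

theorem integral_inv_add {c : ℝ} (hc : 0 ≤ c) {x : ℝ} (hx : x ≠ 0) :
    ∫ t in (0 : ℝ)..c, (t + |x|)⁻¹ = Real.log (c + |x|) - Real.log |x| := by
  have hx' := abs_pos.2 hx
  rw [integral_add_eq (fun t => t⁻¹) c x, integral_inv_of_pos hx' (by linarith),
    Real.log_div (by linarith) hx'.ne']

/-! ### Upper bounds for the representing function -/

section Integrator

variable (a b : ℂ) {γ : ℂ} {n : ℕ}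

theorem continuousOn_integratorFun (hk : -1 < ((n + 1 : ℕ) : ℝ) - γ.re) (φ : SchwartzMap ℝ ℂ) :
    ContinuousOn (integratorFun a b γ n φ) {0}ᶜ := by
  obtain ⟨C, hC, h⟩ := norm_profile_le a b hk (fourierDeriv (n + 1) φ)
  rw [← re_exponent] at h
  exact continuousOn_dilationMean n (by rw [re_exponent]; linarith)
    (continuous_profile a b hk _) hC.le h

theorem norm_integratorFun_le (hk : -1 < ((n + 1 : ℕ) : ℝ) - γ.re) (φ : SchwartzMap ℝ ℂ) :
    ∃ C, 0 < C ∧ ∀ x : ℝ, x ≠ 0 → ‖integratorFun a b γ n φ x‖ ≤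
      C * ∫ t in (0 : ℝ)..1, (t + |x|) ^ (-(((n + 1 : ℕ) : ℝ) + 1 - γ.re)) := by
  obtain ⟨C, hC, h⟩ := norm_profile_le a b hk (fourierDeriv (n + 1) φ)
  rw [← re_exponent] at h ⊢
  exact ⟨C, hC, fun x hx => norm_dilationMean_le n h hx⟩

theorem norm_integratorFun_le_rpow (hk : -1 < ((n + 1 : ℕ) : ℝ) - γ.re) (φ : SchwartzMap ℝ ℂ) :
    ∃ C, 0 < C ∧ ∀ x : ℝ, x ≠ 0 →
      ‖integratorFun a b γ n φ x‖ ≤ C * |x| ^ (-(((n + 1 : ℕ) : ℝ) + 1 - γ.re)) := by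
  obtain ⟨C, hC, h⟩ := norm_integratorFun_le a b hk φ
  refine ⟨C, hC, fun x hx => (h x hx).trans ?_⟩
  gcongr
  exact integral_add_rpow_le_of_le (by linarith) hx

theorem exists_decay_integratorFun (hk : -1 < ((n + 1 : ℕ) : ℝ) - γ.re) (φ : SchwartzMap ℝ ℂ) :
    ∃ c : ℝ, 0 < c ∧ ∀ x : ℝ, 1 ≤ |x| →
      ‖integratorFun a b γ n φ x‖ ≤ c / |x| ^ (((n + 1 : ℕ) : ℝ) + 1 - γ.re) := by
  obtain ⟨C, hC, h⟩ := norm_integratorFun_le_rpow a b hk φ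
  refine ⟨C, hC, fun x hx => ?_⟩
  have := h x (abs_pos.1 (by linarith))
  rwa [Real.rpow_neg (abs_nonneg x), ← div_eq_mul_inv] at this

/-- The pure power bound already holds, and `1 + log|x| ≥ 1`, so the logarithm only weakens it. -/
theorem exists_log_decay_integratorFun (hk : -1 < ((n + 1 : ℕ) : ℝ) - γ.re)
    (φ : SchwartzMap ℝ ℂ) :
    ∃ c : ℝ, 0 < c ∧ ∀ x : ℝ, 1 ≤ |x| → ‖integratorFun a b γ n φ x‖ ≤
      c * ((1 + Real.log |x|) / |x| ^ (((n + 1 : ℕ) : ℝ) + 1 - γ.re)) := by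
  obtain ⟨C, hC, h⟩ := exists_decay_integratorFun a b hk φ
  refine ⟨C, hC, fun x hx => (h x hx).trans ?_⟩
  rw [div_eq_mul_one_div]
  gcongr
  linarith [Real.log_nonneg hx]

/-- An `L_p` criterion for the integrator in terms of its growth exponent at the origin. -/
theorem memLp_integratorFun (hk : -1 < ((n + 1 : ℕ) : ℝ) - γ.re) (φ : SchwartzMap ℝ ℂ)
    {u p : ℝ} (hp : 1 / (((n + 1 : ℕ) : ℝ) + 1 - γ.re) < p) (hu : u * p < 1)
    (h0 : ∃ C, ∀ x : ℝ, x ≠ 0 → ‖integratorFun a b γ n φ x‖ ≤ C * |x| ^ (-u)) :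
    MemLp (integratorFun a b γ n φ) (ENNReal.ofReal p) volume := by
  obtain ⟨C₀, h0⟩ := h0
  obtain ⟨C₁, hC₁, h1⟩ := norm_integratorFun_le_rpow a b hk φ
  have hs : 0 < ((n + 1 : ℕ) : ℝ) + 1 - γ.re := by linarith
  have hp0 : 0 < p := (one_div_pos.2 hs).trans hp
  rw [div_lt_iff₀ hs, mul_comm] at hp
  refine memLp_of_rpow_bounds (continuousOn_integratorFun a b hk φ) (C := max C₀ C₁) hp0 hu hp
    (fun x hx _ => (h0 x hx).trans ?_)
    (fun x hx => (h1 x (abs_pos.1 (by linarith))).trans ?_)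
  · gcongr; exact le_max_left _ _
  · gcongr; exact le_max_right _ _

theorem norm_integratorFun_le_of_sub_lt (hk : -1 < ((n + 1 : ℕ) : ℝ) - γ.re)
    (φ : SchwartzMap ℝ ℂ) {u : ℝ} (hu : 0 ≤ u) (hus : u ≤ ((n + 1 : ℕ) : ℝ) + 1 - γ.re)
    (hk' : ((n + 1 : ℕ) : ℝ) - γ.re < u) :
    ∃ C, ∀ x : ℝ, x ≠ 0 → ‖integratorFun a b γ n φ x‖ ≤ C * |x| ^ (-u) := by
  obtain ⟨C, hC, h⟩ := norm_integratorFun_le a b hk φ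
  refine ⟨C * (1 / (1 - (((n + 1 : ℕ) : ℝ) + 1 - γ.re - u))), fun x hx => (h x hx).trans ?_⟩
  rw [mul_assoc]
  gcongr
  exact integral_add_rpow_le hu hus (by linarith) hx

theorem norm_integratorFun_le_of_pos (hk : 0 < ((n + 1 : ℕ) : ℝ) - γ.re) (φ : SchwartzMap ℝ ℂ) :
    ∃ C, ∀ x : ℝ, x ≠ 0 →
      ‖integratorFun a b γ n φ x‖ ≤ C * |x| ^ (-(((n + 1 : ℕ) : ℝ) - γ.re)) := by
  obtain ⟨C, hC, h⟩ := norm_integratorFun_le a b (by linarith) φ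
  refine ⟨C * (1 / (((n + 1 : ℕ) : ℝ) + 1 - γ.re - 1)), fun x hx => (h x hx).trans ?_⟩
  rw [mul_assoc]
  gcongr
  refine (integral_add_rpow_le_of_one_lt (by linarith) hx).trans (le_of_eq ?_)
  congr 2
  ring

theorem boundedNearZero_rpow_mul_integratorFun (hk : 0 < ((n + 1 : ℕ) : ℝ) - γ.re)
    (φ : SchwartzMap ℝ ℂ) :
    BoundedNearZero (fun x => |x| ^ (((n + 1 : ℕ) : ℝ) - γ.re) * ‖integratorFun a b γ n φ x‖) := by
  obtain ⟨C, h⟩ := norm_integratorFun_le_of_pos a b hk φ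
  refine ⟨C, eventually_mem_nhdsWithin.mono fun x hx => ?_⟩
  have hx' : 0 < |x| := abs_pos.2 hx
  rw [abs_of_nonneg (by positivity)]
  have := mul_le_mul_of_nonneg_left (h x hx)
    (Real.rpow_nonneg hx'.le (((n + 1 : ℕ) : ℝ) - γ.re))
  rwa [mul_left_comm, ← Real.rpow_add hx', add_neg_cancel, Real.rpow_zero, mul_one] at this

theorem memLp_integratorFun_of_pos (hk : 0 < ((n + 1 : ℕ) : ℝ) - γ.re) (φ : SchwartzMap ℝ ℂ)
    {p : ℝ} (hp : 1 / (((n + 1 : ℕ) : ℝ) + 1 - γ.re) < p)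
    (hp' : p < 1 / (((n + 1 : ℕ) : ℝ) - γ.re)) :
    MemLp (integratorFun a b γ n φ) (ENNReal.ofReal p) volume := by
  rw [lt_div_iff₀ hk, mul_comm] at hp'
  exact memLp_integratorFun a b (by linarith) φ hp hp' (norm_integratorFun_le_of_pos a b hk φ)

theorem boundedNearZero_integratorFun_of_neg (hk : -1 < ((n + 1 : ℕ) : ℝ) - γ.re)
    (hk' : ((n + 1 : ℕ) : ℝ) - γ.re < 0) (φ : SchwartzMap ℝ ℂ) :
    BoundedNearZero (fun x => ‖integratorFun a b γ n φ x‖) := by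
  obtain ⟨C, h⟩ := norm_integratorFun_le_of_sub_lt a b hk φ le_rfl (by linarith) hk'
  refine ⟨C, eventually_mem_nhdsWithin.mono fun x hx => ?_⟩
  simpa using h x hx

theorem boundedNearZero_integratorFun_div_log (hk : ((n + 1 : ℕ) : ℝ) - γ.re = 0)
    (φ : SchwartzMap ℝ ℂ) :
    BoundedNearZero (fun x => ‖integratorFun a b γ n φ x‖ / Real.log |x|) := by
  obtain ⟨C, hC, h⟩ := norm_integratorFun_le a b (by linarith) φ
  have hs : -(((n + 1 : ℕ) : ℝ) + 1 - γ.re) = -1 := by linarith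
  simp_rw [hs, Real.rpow_neg_one] at h
  refine ⟨C * 2, ?_⟩
  -- For `|x| < 1/2` both `log(1+|x|) ≤ log 2` and `log 2 < -log|x|`, so the kernel integral is at
  -- most `-2 log|x|`; hence the constant `2 C`.
  have hnear : ∀ᶠ x : ℝ in 𝓝[≠] 0, |x| < 1 / 2 :=
    nhdsWithin_le_nhds ((continuous_abs.tendsto' 0 0 abs_zero).eventually
      (gt_mem_nhds (by norm_num)))
  filter_upwards [hnear, eventually_mem_nhdsWithin] with x hx hx0
  have hx' : 0 < |x| := abs_pos.2 hx0
  have h1 := h x hx0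
  rw [integral_inv_add zero_le_one hx0] at h1
  have h2 : Real.log |x| < -Real.log 2 := by
    rw [← Real.log_inv, ← one_div]; exact Real.log_lt_log hx' hx
  have h3 : Real.log (1 + |x|) ≤ Real.log 2 := Real.log_le_log (by positivity) (by linarith)
  have h4 : 0 < Real.log 2 := Real.log_pos one_lt_two
  rw [abs_div, abs_norm, abs_of_neg (by linarith), div_le_iff₀ (by linarith)]
  refine h1.trans ?_
  nlinarith

end Integrator

/-! ### Continuity as a tempered distribution -/

theorem integrable_rpow_div_one_add_pow {p : ℝ} (hp : -1 < p) {m : ℕ} (hm : p + 2 ≤ m) :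
    Integrable fun ω : ℝ => |ω| ^ p * ((1 + |ω|) ^ m)⁻¹ := by
  have hpos : ∀ ω : ℝ, 0 < 1 + |ω| := fun ω => by positivity
  have hmeas : Measurable fun ω : ℝ => |ω| ^ p * ((1 + |ω|) ^ m)⁻¹ :=
    (measurable_norm.pow_const p).mul (((measurable_norm.const_add 1).pow_const m).inv)
  have key : IntegrableOn (fun ω : ℝ => |ω| ^ p * ((1 + |ω|) ^ m)⁻¹) (Ioi 0) := by
    refine integrableOn_Ioi_of_rpow_bounds hmeas.aestronglyMeasurable (C := 1) (u := -p) (v := 2)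
      (by linarith) one_lt_two (fun x hx _ => ?_) (fun x hx => ?_)
    · rw [Real.norm_of_nonneg (by positivity), neg_neg, one_mul, abs_of_pos hx]
      exact mul_le_of_le_one_right (by positivity)
        (inv_le_one_of_one_le₀ (one_le_pow₀ (by linarith)))
    · have hx0 : 0 < x := by linarith
      rw [Real.norm_of_nonneg (by positivity), one_mul, abs_of_pos hx0, ← div_eq_mul_inv,
        div_le_iff₀ (by positivity)]
      calc x ^ p ≤ x ^ (-2 + (m : ℝ)) := Real.rpow_le_rpow_of_exponent_le hx (by linarith)
        _ = x ^ (-2 : ℝ) * x ^ m := by rw [Real.rpow_add hx0, Real.rpow_natCast]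
        _ ≤ x ^ (-2 : ℝ) * (1 + x) ^ m := by gcongr; linarith
  exact integrable_of_Ioi_of_comp_neg key (by simpa using key)

/-- The adjoint integrator as a tempered distribution. -/
theorem exists_temperedDistribution_adjIntegrator (a b : ℂ) {γ : ℂ} {n : ℕ}
    (hk : -1 < ((n + 1 : ℕ) : ℝ) - γ.re) (φ : SchwartzMap ℝ ℂ) :
    ∃ T : TemperedDistribution ℝ ℂ, ∀ ψ : SchwartzMap ℝ ℂ,
      T ψ = adjIntegrator a b γ (n + 1) φ ψ := by
  obtain ⟨C, hC, h⟩ := exists_norm_adjSymbol_le a b γ n φ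
  set p := ((n + 1 : ℕ) : ℝ) - γ.re with hp
  obtain ⟨m, hm⟩ := exists_nat_ge (p + 2)
  have hi := integrable_rpow_div_one_add_pow hk hm
  have hint := integrable_adjSymbol_mul a b hk φ
  -- The symbol is `O(|ω|^p)`, so seminorms without derivatives and with weights up to order `m ≥ p
  -- + 2` control the pairing.
  have hbound : ∀ θ : SchwartzMap ℝ ℂ, ‖∫ ω, adjSymbol a b γ (n + 1) φ ω * θ ω‖ ≤
      (C * 2 ^ m * ∫ ω : ℝ, |ω| ^ p * ((1 + |ω|) ^ m)⁻¹) *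
        (Finset.Iic (m, 0)).sup (schwartzSeminormFamily ℂ ℝ ℂ) θ := fun θ => by
    have hle : ∀ ω : ℝ, ‖adjSymbol a b γ (n + 1) φ ω * θ ω‖ ≤
        C * 2 ^ m * (Finset.Iic (m, 0)).sup (schwartzSeminormFamily ℂ ℝ ℂ) θ *
          (|ω| ^ p * ((1 + |ω|) ^ m)⁻¹) := fun ω => by
      have hs := SchwartzMap.one_add_le_sup_seminorm_apply (𝕜 := ℂ) (m := (m, 0)) (k := m)
        (n := 0) le_rfl le_rfl θ ω
      rw [norm_iteratedFDeriv_zero, Real.norm_eq_abs] at hs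
      have hpos : 0 < (1 + |ω|) ^ m := by positivity
      have hθ : ‖θ ω‖ ≤ 2 ^ m * (Finset.Iic (m, 0)).sup (schwartzSeminormFamily ℂ ℝ ℂ) θ *
          ((1 + |ω|) ^ m)⁻¹ := by
        rw [← div_eq_mul_inv, le_div_iff₀ hpos, mul_comm]
        exact hs
      rw [norm_mul]
      refine (mul_le_mul (h ω) hθ (norm_nonneg _) (by positivity)).trans (le_of_eq ?_)
      ring
    refine (norm_integral_le_of_norm_le (hi.const_mul _) (Eventually.of_forall hle)).trans
      (le_of_eq ?_)
    rw [integral_const_mul]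
    ring
  let L : SchwartzMap ℝ ℂ →L[ℂ] ℂ := SchwartzMap.mkCLMtoNormedSpace
    (fun θ => ∫ ω, adjSymbol a b γ (n + 1) φ ω * θ ω)
    (fun f g => by
      rw [← integral_add (hint f) (hint g)]
      simp [mul_add])
    (fun c f => by
      rw [RingHom.id_apply, smul_eq_mul, ← integral_const_mul]
      simp [mul_left_comm])
    ⟨_, _, mul_nonneg (by positivity) (integral_nonneg fun ω => by positivity), hbound⟩
  refine ⟨ContinuousLinearMap.toPointwiseConvergenceCLM _ _ _ _ (L.comp schwartzFourierInv),
    fun ψ => ?_⟩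
  rw [adjIntegrator, ← coe_schwartzFourierInv]
  rfl

/-! ### Natural `γ`: logarithmic asymptotics and the pure case -/

/-- Subtracting `η(0)/(1+|y|)` from a decaying Lipschitz function leaves an integrable error on the
multiplicative group. -/
theorem norm_sub_div_one_add_abs_le {η : ℝ → ℂ} {C C' : ℝ} (hC : 0 ≤ C) (hC' : 0 ≤ C')
    (hη : ∀ x : ℝ, ‖η x‖ ≤ C * (1 + |x|)⁻¹) (hη' : ∀ x : ℝ, ‖η x - η 0‖ ≤ C' * |x|) :
    ∃ K, 0 ≤ K ∧ ∀ y : ℝ, ‖η y - η 0 * ((1 + |y|)⁻¹ : ℝ)‖ ≤ K * (|y| * ((1 + |y|) ^ 2)⁻¹) := by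
  refine ⟨4 * (C' + ‖η 0‖) + 2 * (C + ‖η 0‖), by positivity, fun y => ?_⟩
  set r := |y| with hr
  have hr0 : 0 ≤ r := abs_nonneg y
  have hp : 0 < 1 + r := by positivity
  have hN := norm_nonneg (η 0)
  rw [← div_eq_mul_inv r, ← mul_div_assoc, le_div_iff₀ (by positivity)]
  -- The Lipschitz bound handles `|y| ≤ 1`, the decay of `η` handles `|y| ≥ 1`.
  rcases le_total r 1 with h | h
  · have h1 : ‖η y - η 0 * ((1 + r)⁻¹ : ℝ)‖ ≤ (C' + ‖η 0‖) * r := by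
      have e : η y - η 0 * ((1 + r)⁻¹ : ℝ) = (η y - η 0) + η 0 * ((r * (1 + r)⁻¹ : ℝ) : ℂ) := by
        have hr1 : (1 + r : ℂ) ≠ 0 := by exact_mod_cast hp.ne'
        push_cast
        field_simp
        ring
      rw [e]
      refine (norm_add_le _ _).trans ?_
      rw [norm_mul, Complex.norm_real, Real.norm_of_nonneg (by positivity), add_mul]
      have h2 : r * (1 + r)⁻¹ ≤ r :=
        mul_le_of_le_one_right hr0 (inv_le_one_of_one_le₀ (by linarith))
      exact add_le_add (hη' y) (mul_le_mul_of_nonneg_left h2 hN)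
    calc _ ≤ (C' + ‖η 0‖) * r * (1 + r) ^ 2 := by gcongr
      _ ≤ (C' + ‖η 0‖) * r * 4 := by gcongr; nlinarith
      _ ≤ _ := by nlinarith [mul_nonneg (add_nonneg hC hN) hr0]
  · have h1 : ‖η y - η 0 * ((1 + r)⁻¹ : ℝ)‖ ≤ (C + ‖η 0‖) * (1 + r)⁻¹ := by
      refine (norm_sub_le _ _).trans ?_
      rw [norm_mul, Complex.norm_real, Real.norm_of_nonneg (by positivity), add_mul]
      exact add_le_add (hη y) le_rfl
    calc _ ≤ (C + ‖η 0‖) * (1 + r)⁻¹ * (1 + r) ^ 2 := by gcongr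
      _ = (C + ‖η 0‖) * (1 + r) := by field_simp
      _ ≤ (C + ‖η 0‖) * (2 * r) := by gcongr; linarith
      _ ≤ _ := by nlinarith [mul_nonneg (add_nonneg hC' hN) hr0]

/-- For `σ = 1` the weighted mean of dilates is logarithmic up to a bounded error. -/
theorem exists_norm_dilationMean_one_sub_le (n : ℕ) {η : ℝ → ℂ} (hc : Continuous η) {C C' : ℝ}
    (hC : 0 ≤ C) (hC' : 0 ≤ C')
    (hη : ∀ x : ℝ, ‖η x‖ ≤ C * (1 + |x|)⁻¹) (hη' : ∀ x : ℝ, ‖η x - η 0‖ ≤ C' * |x|) :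
    ∃ K, ∀ x : ℝ, x ≠ 0 → ‖dilationMean n 1 η x - 1 / (n.factorial : ℂ) *
      (η 0 * ((∫ t in (0 : ℝ)..1, (1 - t) ^ n * (t + |x|)⁻¹ : ℝ) : ℂ))‖ ≤ K := by
  obtain ⟨K, hK, h⟩ := norm_sub_div_one_add_abs_le hC hC' hη hη'
  refine ⟨K, fun x hx => ?_⟩
  have hx' : 0 < |x| := abs_pos.2 hx
  have hη1 : ∀ x : ℝ, ‖η x‖ ≤ C * (1 + |x|) ^ (-(1 : ℂ).re) := fun x => by
    simpa [Real.rpow_neg_one] using hη x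
  have i1 : IntervalIntegrable (fun t : ℝ => ((1 - t : ℝ) : ℂ) ^ n *
      ((t : ℂ) ^ (-(1 : ℂ)) * η (x / t))) volume 0 1 := by
    rw [intervalIntegrable_iff_integrableOn_Ioc_of_le zero_le_one]
    have hi := ((intervalIntegrable_add_rpow hx (-(1 : ℂ).re)).const_mul C).1
    refine hi.mono' ((measurable_dilationMean_integrand n 1 hc).comp
        (measurable_id.prodMk measurable_const)).aestronglyMeasurable ?_
    exact (ae_restrict_iff' measurableSet_Ioc).2 (Eventually.of_forall fun t ht =>
      norm_dilationMean_integrand_le n hη1 ht.1 ht.2 x)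
  have hcont : ContinuousOn (fun t : ℝ => (1 - t) ^ n * (t + |x|)⁻¹) (uIcc 0 1) := by
    rw [uIcc_of_le zero_le_one]
    exact ContinuousOn.mul (by fun_prop) (ContinuousOn.inv₀ (by fun_prop)
      fun t ht => by linarith [ht.1])
  have i2 : IntervalIntegrable
      (fun t : ℝ => η 0 * (((1 - t) ^ n * (t + |x|)⁻¹ : ℝ) : ℂ)) volume 0 1 :=
    (Complex.continuous_ofReal.comp_continuousOn hcont).intervalIntegrable.const_mul _
  rw [← intervalIntegral.integral_ofReal, ← intervalIntegral.integral_const_mul, dilationMean,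
    ← mul_sub, ← intervalIntegral.integral_sub i1 i2, norm_mul]
  refine (mul_le_of_le_one_left (norm_nonneg _) (norm_one_div_factorial_le n)).trans ?_
  -- With `y = x/t`, the error `t⁻¹ |y| (1+|y|)^(-2)` equals `|x| (t+|x|)^(-2)`, whose integral over
  -- `t` is at most `1` for every `x ≠ 0`.
  have i3 := (intervalIntegrable_add_rpow hx (-2)).const_mul (K * |x|)
  refine (intervalIntegral.norm_integral_le_of_norm_le zero_le_one
    (Eventually.of_forall fun t ht => ?_) i3).trans ?_
  · have ht0 : (t : ℂ) ≠ 0 := by exact_mod_cast ht.1.ne'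
    have ht1 := ht.1
    have e : ((1 - t : ℝ) : ℂ) ^ n * ((t : ℂ) ^ (-(1 : ℂ)) * η (x / t)) -
        η 0 * (((1 - t) ^ n * (t + |x|)⁻¹ : ℝ) : ℂ) = ((1 - t : ℝ) : ℂ) ^ n *
        (((t⁻¹ : ℝ) : ℂ) * (η (x / t) - η 0 * ((1 + |x / t|)⁻¹ : ℝ))) := by
      have e1 : (t + |x|)⁻¹ = t⁻¹ * (1 + |x / t|)⁻¹ := by
        rw [abs_div, abs_of_pos ht1]; field_simp
      rw [e1, Complex.cpow_neg_one]
      push_cast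
      ring
    rw [e, norm_mul, norm_mul, Complex.norm_real, Real.norm_of_nonneg (by positivity)]
    refine (mul_le_of_le_one_left (by positivity) (norm_one_sub_pow_le n ht1.le ht.2)).trans ?_
    refine (mul_le_mul_of_nonneg_left (h (x / t)) (by positivity)).trans (le_of_eq ?_)
    rw [abs_div, abs_of_pos ht1, Real.rpow_neg (by positivity), Real.rpow_two]
    field_simp
  · rw [intervalIntegral.integral_const_mul]
    have h2 : ∫ t in (0 : ℝ)..1, (t + |x|) ^ (-2 : ℝ) ≤ |x|⁻¹ := by
      refine (integral_add_rpow_le_of_one_lt one_lt_two hx).trans (le_of_eq ?_)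
      rw [show (1 : ℝ) - 2 = -1 by norm_num, Real.rpow_neg_one]
      norm_num
    calc K * |x| * ∫ t in (0 : ℝ)..1, (t + |x|) ^ (-2 : ℝ) ≤ K * |x| * |x|⁻¹ := by gcongr
      _ = K := by field_simp

/-- The integrand is non-negative, so restrict to `t ≤ 1/2`, where `(1-t)^n ≥ 2^(-n)`. -/
theorem le_integral_pow_mul_inv_add (n : ℕ) {x : ℝ} (hx : x ≠ 0) :
    (1 / 2) ^ n * (-Real.log 2 - Real.log |x|) ≤
      ∫ t in (0 : ℝ)..1, (1 - t) ^ n * (t + |x|)⁻¹ := by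
  have hx' : 0 < |x| := abs_pos.2 hx
  have hcont : ContinuousOn (fun t : ℝ => (1 - t) ^ n * (t + |x|)⁻¹) (Icc 0 1) :=
    ContinuousOn.mul (by fun_prop) (ContinuousOn.inv₀ (by fun_prop)
      fun t ht => by linarith [ht.1])
  have i1 : IntervalIntegrable (fun t : ℝ => (1 - t) ^ n * (t + |x|)⁻¹) volume 0 1 :=
    ContinuousOn.intervalIntegrable (by rwa [uIcc_of_le zero_le_one])
  have i2 : IntervalIntegrable (fun t : ℝ => (1 - t) ^ n * (t + |x|)⁻¹) volume 0 (1 / 2) :=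
    ContinuousOn.intervalIntegrable (by
      rw [uIcc_of_le (by norm_num)]
      exact hcont.mono (Icc_subset_Icc le_rfl (by norm_num)))
  have i3 : IntervalIntegrable (fun t : ℝ => (1 / 2) ^ n * (t + |x|)⁻¹) volume 0 (1 / 2) :=
    ContinuousOn.intervalIntegrable (by
      rw [uIcc_of_le (by norm_num)]
      exact ContinuousOn.mul (by fun_prop) (ContinuousOn.inv₀ (by fun_prop)
        fun t ht => by linarith [ht.1]))
  have h1 := intervalIntegral.integral_mono_on (by norm_num : (0 : ℝ) ≤ 1 / 2) i3 i2 fun t ht => by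
    have := ht.1
    have := ht.2
    gcongr
    linarith
  have h2 := intervalIntegral.integral_mono_interval (c := 0) (d := 1) le_rfl
    (by norm_num : (0 : ℝ) ≤ 1 / 2) (by norm_num) ((ae_restrict_iff' measurableSet_Ioc).2
      (Eventually.of_forall fun t ht => by
        have := ht.1
        have h3 : 0 ≤ 1 - t := by linarith [ht.2]
        show 0 ≤ (1 - t) ^ n * (t + |x|)⁻¹
        positivity)) i1
  refine le_trans ?_ (h1.trans h2)
  rw [intervalIntegral.integral_const_mul, integral_inv_add (by norm_num) hx]
  gcongr
  rw [← Real.log_inv]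
  exact Real.log_le_log (by norm_num) (by norm_num)

theorem integral_Ioi_schwartzDeriv (n : ℕ) (f : SchwartzMap ℝ ℂ) :
    ∫ ω in Ioi 0, schwartzDeriv (n + 1) f ω = -schwartzDeriv n f 0 := by
  have h := integral_Ioi_of_hasDerivAt_of_tendsto' (a := 0)
    (fun x _ => hasDerivAt_schwartzDeriv n f x) (schwartzDeriv (n + 1) f).integrable.integrableOn
    (((schwartzDeriv n f).toZeroAtInfty.zero_at_infty').mono_left atTop_le_cocompact)
  simpa using h

theorem integral_Ioi_schwartzDeriv_neg (n : ℕ) (f : SchwartzMap ℝ ℂ) :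
    ∫ ω in Ioi 0, schwartzDeriv (n + 1) f (-ω) = schwartzDeriv n f 0 := by
  have h := integral_Iic_of_hasDerivAt_of_tendsto' (a := 0)
    (fun x _ => hasDerivAt_schwartzDeriv n f x) (schwartzDeriv (n + 1) f).integrable.integrableOn
    (((schwartzDeriv n f).toZeroAtInfty.zero_at_infty').mono_left atBot_le_cocompact)
  rw [integral_comp_neg_Ioi, neg_zero, h, sub_zero]

/-- When `γ = k` the quotient is constant on each half-line, and the half-line integrals of `φ̂^(k)`
are `∓φ̂^(k-1)(0)`. This is where that derivative enters the theorem. -/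
theorem profile_natCast_zero (a b : ℂ) (n : ℕ) (φ : SchwartzMap ℝ ℂ) :
    profile a b ((n + 1 : ℕ) : ℂ) (n + 1) (fourierDeriv (n + 1) φ) 0 =
      1 / (2 * (Real.pi : ℂ)) * (iteratedDeriv n (fourier φ) 0 * ((-1) ^ (n + 1) / a - 1 / b)) := by
  rw [profile_eq a b (by simp)]
  simp only [oneSided, sub_self, Complex.cpow_zero, one_mul, neg_zero, Complex.ofReal_zero,
    mul_zero, Complex.exp_zero, mul_one, schwartzReflect_apply, integral_Ioi_schwartzDeriv,
    integral_Ioi_schwartzDeriv_neg, coe_schwartzDeriv n, coe_schwartzFourier]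
  ring

/-- Comparing the values at `±1` forces `a = (-1)^(n+1) b`, and conversely `d = a` works. The
criterion is stated as the vanishing of the factor in `profile_natCast_zero`. -/
theorem isPureInteger_natCast_iff {a b : ℂ} (ha : a ≠ 0) (hb : b ≠ 0) (n : ℕ) :
    IsPureInteger a b ((n + 1 : ℕ) : ℂ) ↔ (-1) ^ (n + 1) / a - 1 / b = 0 := by
  have hsq : ((-1 : ℂ) ^ (n + 1)) * (-1) ^ (n + 1) = 1 := by
    rw [← mul_pow]; norm_num
  rw [div_sub_div _ _ ha hb, div_eq_zero_iff, or_iff_left (mul_ne_zero ha hb), sub_eq_zero]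
  constructor
  · rintro ⟨m, hm, d, hd⟩
    have hm' : n + 1 = m := by exact_mod_cast hm
    subst hm'
    have h1 := hd 1
    have h2 := hd (-1)
    simp [homMultiplier, (zero_le_one' ℝ).not_gt] at h1 h2
    rw [h1, h2]
    linear_combination d * hsq
  · intro h
    refine ⟨n + 1, rfl, a, fun ω => ?_⟩
    refine real_sign_cases (P := fun ω => homMultiplier a b ((n + 1 : ℕ) : ℂ) ω
      = a * (ω : ℂ) ^ (n + 1)) ?_ (fun ω hω => ?_) (fun ω hω => ?_) ω
    · simp [homMultiplier]
    · rw [homMultiplier, if_pos hω, abs_of_pos hω, Complex.cpow_natCast]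
    · rw [homMultiplier, if_neg (by linarith), if_pos (by linarith), abs_neg, abs_of_pos hω,
        Complex.cpow_natCast, Complex.ofReal_neg, neg_pow]
      linear_combination (-1 : ℂ) ^ (n + 1) * (ω : ℂ) ^ (n + 1) * h
        - b * (ω : ℂ) ^ (n + 1) * hsq

theorem integratorFun_natCast (a b : ℂ) (n : ℕ) (φ : SchwartzMap ℝ ℂ) :
    integratorFun a b ((n + 1 : ℕ) : ℂ) n φ = dilationMean n 1
      (profile a b ((n + 1 : ℕ) : ℂ) (n + 1) (fourierDeriv (n + 1) φ)) := by
  rw [integratorFun, add_sub_cancel_left]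

theorem exists_norm_integratorFun_natCast_sub_le (a b : ℂ) (n : ℕ) (φ : SchwartzMap ℝ ℂ) :
    ∃ K, ∀ x : ℝ, x ≠ 0 → ‖integratorFun a b ((n + 1 : ℕ) : ℂ) n φ x - 1 / (n.factorial : ℂ) *
      (profile a b ((n + 1 : ℕ) : ℂ) (n + 1) (fourierDeriv (n + 1) φ) 0 *
        ((∫ t in (0 : ℝ)..1, (1 - t) ^ n * (t + |x|)⁻¹ : ℝ) : ℂ))‖ ≤ K := by
  have hk : -1 < ((n + 1 : ℕ) : ℝ) - ((n + 1 : ℕ) : ℂ).re := by simp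
  obtain ⟨C, hC, h⟩ := norm_profile_le a b hk (fourierDeriv (n + 1) φ)
  obtain ⟨C', hC', h'⟩ := norm_profile_sub_le a b hk (fourierDeriv (n + 1) φ)
  rw [Complex.natCast_re, add_sub_cancel_left] at h
  simp_rw [Real.rpow_neg_one] at h
  rw [integratorFun_natCast]
  exact exists_norm_dilationMean_one_sub_le n (continuous_profile a b hk _) hC.le hC' h h'

theorem tendsto_norm_integratorFun_natCast {a b : ℂ} (ha : a ≠ 0) (hb : b ≠ 0) (n : ℕ)
    (φ : SchwartzMap ℝ ℂ) (hpure : ¬ IsPureInteger a b ((n + 1 : ℕ) : ℂ))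
    (hφ : iteratedDeriv n (fourier φ) 0 ≠ 0) :
    Tendsto (fun x => ‖integratorFun a b ((n + 1 : ℕ) : ℂ) n φ x‖) (𝓝[≠] 0) atTop := by
  obtain ⟨K, hK⟩ := exists_norm_integratorFun_natCast_sub_le a b n φ
  set η₀ := profile a b ((n + 1 : ℕ) : ℂ) (n + 1) (fourierDeriv (n + 1) φ) 0 with hη₀
  have hne : 1 / (n.factorial : ℂ) * η₀ ≠ 0 := by
    rw [isPureInteger_natCast_iff ha hb] at hpure
    have hpi : (Real.pi : ℂ) ≠ 0 := by exact_mod_cast Real.pi_ne_zero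
    have hf : (n.factorial : ℂ) ≠ 0 := by exact_mod_cast n.factorial_ne_zero
    rw [hη₀, profile_natCast_zero]
    exact mul_ne_zero (one_div_ne_zero hf) (mul_ne_zero (one_div_ne_zero
      (mul_ne_zero two_ne_zero hpi)) (mul_ne_zero hφ hpure))
  set κ := ‖1 / (n.factorial : ℂ) * η₀‖ with hκ
  have hκ0 : 0 < κ := norm_pos_iff.2 hne
  have hlow : ∀ x : ℝ, x ≠ 0 → κ * ((1 / 2) ^ n * (-Real.log 2 - Real.log |x|)) - K ≤
      ‖integratorFun a b ((n + 1 : ℕ) : ℂ) n φ x‖ := fun x hx => by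
    have h1 := hK x hx
    have h2 := le_integral_pow_mul_inv_add n hx
    set J := ∫ t in (0 : ℝ)..1, (1 - t) ^ n * (t + |x|)⁻¹
    rw [← mul_assoc] at h1
    have h3 := (norm_sub_norm_le (1 / (n.factorial : ℂ) * η₀ * (J : ℂ)) _).trans
      ((norm_sub_rev _ _).le.trans h1)
    rw [norm_mul, ← hκ, Complex.norm_real] at h3
    have h4 := mul_le_mul_of_nonneg_left (h2.trans (le_abs_self J)) hκ0.le
    rw [Real.norm_eq_abs] at h3
    linarith
  refine tendsto_atTop_mono' _ (eventually_mem_nhdsWithin.mono fun x hx => hlow x hx) ?_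
  have hlog : Tendsto (fun x : ℝ => -Real.log 2 + -Real.log |x|) (𝓝[≠] 0) atTop := by
    refine tendsto_atTop_add_const_left _ _ (tendsto_neg_atBot_atTop.comp ?_)
    simp_rw [Real.log_abs]
    exact Real.tendsto_log_nhdsNE_zero
  exact tendsto_atTop_add_const_right _ _ (Tendsto.const_mul_atTop hκ0
    (Tendsto.const_mul_atTop (by positivity) hlog))

theorem exists_norm_integratorFun_le_of_isPureInteger {a b : ℂ} (ha : a ≠ 0) (hb : b ≠ 0) (n : ℕ)
    (φ : SchwartzMap ℝ ℂ) (hpure : IsPureInteger a b ((n + 1 : ℕ) : ℂ)) :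
    ∃ K, ∀ x : ℝ, x ≠ 0 → ‖integratorFun a b ((n + 1 : ℕ) : ℂ) n φ x‖ ≤ K := by
  obtain ⟨K, hK⟩ := exists_norm_integratorFun_natCast_sub_le a b n φ
  rw [profile_natCast_zero, (isPureInteger_natCast_iff ha hb n).1 hpure] at hK
  simp only [mul_zero, zero_mul, sub_zero] at hK
  exact ⟨K, hK⟩

/-- The profile is itself Schwartz, so `|η(x/t)| ≤ C |x|^(-v) t^v`, and `t^v` absorbs the weight
`t⁻¹` once `v ≥ 1`. -/
theorem exists_rapid_decay_integratorFun_of_isPureInteger {a b : ℂ} (ha : a ≠ 0) (hb : b ≠ 0)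
    (n : ℕ) (φ : SchwartzMap ℝ ℂ) (hpure : IsPureInteger a b ((n + 1 : ℕ) : ℂ)) {v : ℝ}
    (hv : 1 ≤ v) :
    ∃ K, ∀ x : ℝ, x ≠ 0 → ‖integratorFun a b ((n + 1 : ℕ) : ℂ) n φ x‖ ≤ K * |x| ^ (-v) := by
  have hab := (isPureInteger_natCast_iff ha hb n).1 hpure
  have hprof : profile a b ((n + 1 : ℕ) : ℂ) (n + 1) (fourierDeriv (n + 1) φ) =
      schwartzFourierInv ((1 / b) • fourierDeriv (n + 1) φ) := by
    rw [coe_schwartzFourierInv]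
    ext x
    simp only [profile, fourierInv]
    congr 1
    -- The point `0` is discarded because the quotient takes the default value `0` there.
    refine integral_congr_ae ((Measure.ae_ne volume (0 : ℝ)).mono fun ω hω => ?_)
    have : symbolRatio a b ((n + 1 : ℕ) : ℂ) (n + 1) ω = 1 / b := by
      rcases lt_or_gt_of_ne hω with h | h
      · have := symbolRatio_neg_of_pos a b ((n + 1 : ℕ) : ℂ) (n + 1) (neg_pos.2 h)
        rw [neg_neg, sub_self, Complex.cpow_zero, mul_one] at this
        rw [this, ← sub_eq_zero, hab]
      · rw [symbolRatio_of_pos _ _ _ _ h, sub_self, Complex.cpow_zero, mul_one]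
    simp only [this, _root_.smul_apply, smul_eq_mul]
    ring
  obtain ⟨C, hC, h⟩ := exists_schwartz_norm_le_rpow
    (schwartzFourierInv ((1 / b) • fourierDeriv (n + 1) φ)) v (by linarith)
  rw [← hprof] at h
  refine ⟨C, fun x hx => ?_⟩
  have hx' : 0 < |x| := abs_pos.2 hx
  rw [integratorFun_natCast, dilationMean, norm_mul]
  refine (mul_le_of_le_one_left (norm_nonneg _) (norm_one_div_factorial_le n)).trans ?_
  refine (intervalIntegral.norm_integral_le_of_norm_le_const (C := C * |x| ^ (-v))
    fun t ht => ?_).trans (le_of_eq (by simp))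
  rw [uIoc_of_le zero_le_one] at ht
  have ht0 := ht.1
  rw [norm_mul, norm_mul, Complex.norm_cpow_eq_rpow_re_of_pos ht0]
  refine (mul_le_of_le_one_left (by positivity) (norm_one_sub_pow_le n ht0.le ht.2)).trans ?_
  have h1 := h (x / t) (div_ne_zero hx ht0.ne')
  rw [abs_div, abs_of_pos ht0, Real.div_rpow hx'.le ht0.le, Real.rpow_neg ht0.le v, div_inv_eq_mul]
    at h1
  calc t ^ (-(1 : ℂ)).re * _ ≤ t ^ (-(1 : ℂ)).re * (C * (|x| ^ (-v) * t ^ v)) := by gcongr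
    _ = C * |x| ^ (-v) * (t ^ (-(1 : ℂ)).re * t ^ v) := by ring
    _ = C * |x| ^ (-v) * t ^ (v - 1) := by
        rw [← Real.rpow_add ht0]; congr 2; simp; ring
    _ ≤ C * |x| ^ (-v) := mul_le_of_le_one_right (by positivity)
        (Real.rpow_le_one ht0.le ht.2 (by linarith))

theorem memLp_integratorFun_of_isPureInteger {a b : ℂ} (ha : a ≠ 0) (hb : b ≠ 0)
    (n : ℕ) (φ : SchwartzMap ℝ ℂ) (hpure : IsPureInteger a b ((n + 1 : ℕ) : ℂ)) {p : ℝ}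
    (hp : 0 < p) :
    MemLp (integratorFun a b ((n + 1 : ℕ) : ℂ) n φ) (ENNReal.ofReal p) volume := by
  obtain ⟨K₀, h0⟩ := exists_norm_integratorFun_le_of_isPureInteger ha hb n φ hpure
  obtain ⟨K₁, h1⟩ := exists_rapid_decay_integratorFun_of_isPureInteger ha hb n φ hpure
    (v := max 1 (2 / p)) (le_max_left _ _)
  refine memLp_of_rpow_bounds (continuousOn_integratorFun a b (by simp) φ) (C := max K₀ K₁)
    (u := 0) (v := max 1 (2 / p)) hp (by simp) ?_ (fun x hx _ => ?_) (fun x hx => ?_)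
  · have : 2 / p * p ≤ max 1 (2 / p) * p := by gcongr; exact le_max_right _ _
    rw [div_mul_cancel₀ _ hp.ne'] at this
    linarith
  · simpa using Or.inl (h0 x hx)
  · refine (h1 x (abs_pos.1 (by linarith))).trans ?_
    gcongr
    exact le_max_right _ _

/-! ### Absence of a limit at the origin, by scaling -/

section Singular

variable (a b : ℂ) {γ : ℂ} {n : ℕ}

theorem homMultiplier_mul (γ : ℂ) {t : ℝ} (ht : 0 < t) (ω : ℝ) :
    homMultiplier a b γ (t * ω) = (t : ℂ) ^ γ * homMultiplier a b γ ω := by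
  have e : (((|t * ω| : ℝ) : ℂ)) ^ γ = (t : ℂ) ^ γ * ((|ω| : ℝ) : ℂ) ^ γ := by
    rw [abs_mul, abs_of_pos ht, Complex.ofReal_mul,
      Complex.mul_cpow_ofReal_nonneg ht.le (abs_nonneg ω)]
  unfold homMultiplier
  rw [e]
  simp only [mul_pos_iff_of_pos_left ht, mul_neg_iff, ht, ht.not_gt, true_and, false_and, or_false]
  split_ifs <;> ring

/-- Leading behaviour of the symbol at infinity. -/
theorem tendsto_rpow_mul_adjSymbol (φ : SchwartzMap ℝ ℂ) {u : ℝ} (hu : u ≠ 0) :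
    Tendsto (fun R : ℝ => (R : ℂ) ^ (γ - n) * adjSymbol a b γ (n + 1) φ (R * u)) atTop
      (𝓝 (-(iteratedDeriv n (fourier φ) 0 / (n.factorial : ℂ)) * symbolRatio a b γ n u)) := by
  have hφ : Tendsto (fun R : ℝ => fourier φ (R * u)) atTop (𝓝 0) := by
    rw [← coe_schwartzFourier]
    refine (schwartzFourier φ).toZeroAtInfty.zero_at_infty'.comp ?_
    rw [← Metric.cobounded_eq_cocompact, ← tendsto_norm_atTop_iff_cobounded]
    simp_rw [norm_mul]
    exact tendsto_norm_atTop_atTop.atTop_mul_const (norm_pos_iff.2 hu)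
  have hinv : Tendsto (fun R : ℝ => ((R⁻¹ : ℝ) : ℂ)) atTop (𝓝 0) := by
    have := (Complex.continuous_ofReal.tendsto 0).comp (tendsto_inv_atTop_zero (𝕜 := ℝ))
    rw [Complex.ofReal_zero] at this
    exact this
  -- For `n = 0` this limit is `1`; the product with `φ̂(Ru)` still vanishes, by decay of `φ̂`.
  have hinvn : Tendsto (fun R : ℝ => ((R⁻¹ : ℝ) : ℂ) ^ n) atTop (𝓝 (0 ^ n)) := hinv.pow n
  have hlow : Tendsto (fun R : ℝ => ∑ j ∈ Finset.range n, iteratedDeriv j (fourier φ) 0 /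
      (j.factorial : ℂ) * (u : ℂ) ^ j * ((R⁻¹ : ℝ) : ℂ) ^ (n - j)) atTop (𝓝 0) := by
    have hterm : ∀ j ∈ Finset.range n, Tendsto (fun R : ℝ => iteratedDeriv j (fourier φ) 0 /
        (j.factorial : ℂ) * (u : ℂ) ^ j * ((R⁻¹ : ℝ) : ℂ) ^ (n - j)) atTop (𝓝 0) := fun j hj => by
      have h := (hinv.pow (n - j)).const_mul
        (iteratedDeriv j (fourier φ) 0 / (j.factorial : ℂ) * (u : ℂ) ^ j)
      rwa [zero_pow (Nat.sub_ne_zero_of_lt (Finset.mem_range.1 hj)), mul_zero] at h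
    simpa only [Finset.sum_const_zero] using tendsto_finsetSum (Finset.range n) hterm
  have hmain : Tendsto (fun R : ℝ => (((R⁻¹ : ℝ) : ℂ) ^ n * fourier φ (R * u) -
      ((∑ j ∈ Finset.range n, iteratedDeriv j (fourier φ) 0 / (j.factorial : ℂ) * (u : ℂ) ^ j *
        ((R⁻¹ : ℝ) : ℂ) ^ (n - j)) + iteratedDeriv n (fourier φ) 0 / (n.factorial : ℂ) *
          (u : ℂ) ^ n)) / homMultiplier a b γ (-u)) atTop
      (𝓝 ((0 ^ n * 0 - (0 + iteratedDeriv n (fourier φ) 0 / (n.factorial : ℂ) * (u : ℂ) ^ n)) /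
        homMultiplier a b γ (-u))) :=
    ((hinvn.mul hφ).sub (hlow.add_const _)).div_const _
  have hlim : (0 ^ n * 0 - (0 + iteratedDeriv n (fourier φ) 0 / (n.factorial : ℂ) * (u : ℂ) ^ n)) /
      homMultiplier a b γ (-u) =
      -(iteratedDeriv n (fourier φ) 0 / (n.factorial : ℂ)) * symbolRatio a b γ n u := by
    rw [symbolRatio]; ring
  rw [hlim] at hmain
  refine hmain.congr' ?_
  filter_upwards [eventually_gt_atTop (0 : ℝ)] with R hR
  have hR0 : (R : ℂ) ≠ 0 := by exact_mod_cast hR.ne'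
  have hRγ : (R : ℂ) ^ γ ≠ 0 := by simp [Complex.cpow_eq_zero_iff, hR0]
  rw [adjSymbol, ← mul_neg, homMultiplier_mul a b γ hR, Complex.cpow_sub _ _ hR0,
    Complex.cpow_natCast, Finset.sum_range_succ]
  have hsum : ∑ j ∈ Finset.range n, iteratedDeriv j (fourier φ) 0 / (j.factorial : ℂ) *
      (u : ℂ) ^ j * ((R⁻¹ : ℝ) : ℂ) ^ (n - j) = ((R : ℂ) ^ n)⁻¹ * ∑ j ∈ Finset.range n,
        iteratedDeriv j (fourier φ) 0 / (j.factorial : ℂ) * ((R * u : ℝ) : ℂ) ^ j := by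
    rw [Finset.mul_sum]
    refine Finset.sum_congr rfl fun j hj => ?_
    have hj' := (Finset.mem_range.1 hj).le
    rw [Complex.ofReal_inv, inv_pow, Complex.ofReal_mul, mul_pow, pow_sub₀ _ hR0 hj']
    field_simp
  rw [hsum]
  generalize ∑ j ∈ Finset.range n,
    iteratedDeriv j (fourier φ) 0 / (j.factorial : ℂ) * ((R * u : ℝ) : ℂ) ^ j = S
  rw [Complex.ofReal_inv, inv_pow, Complex.ofReal_mul, mul_pow]
  field_simp

/-- At high frequency the numerator is of order `|ω|^n`, from the Taylor polynomial, against
`|ω|^(n+1)` below. This supplies the dominating function for the scaling limit. -/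
theorem exists_norm_adjSymbol_le_div (hk : γ.re = ((n + 1 : ℕ) : ℝ)) (φ : SchwartzMap ℝ ℂ) :
    ∃ C, 0 < C ∧ ∀ ω : ℝ, 1 ≤ |ω| → ‖adjSymbol a b γ (n + 1) φ ω‖ ≤ C / |ω| := by
  obtain ⟨M, hM, h⟩ := (schwartzFourier φ).decay 0 0
  simp only [pow_zero, one_mul, norm_iteratedFDeriv_zero, schwartzFourier_apply] at h
  set S := ∑ j ∈ Finset.range (n + 1), ‖iteratedDeriv j (fourier φ) 0 / (j.factorial : ℂ)‖ with hS
  have hS0 : 0 ≤ S := Finset.sum_nonneg fun _ _ => norm_nonneg _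
  refine ⟨(M + S) * (‖1 / b‖ + ‖1 / a‖) + 1, by positivity, fun ω hω => ?_⟩
  have hω0 : 0 < |ω| := by linarith
  have hnum : ‖fourier φ ω - ∑ j ∈ Finset.range (n + 1),
      iteratedDeriv j (fourier φ) 0 / (j.factorial : ℂ) * (ω : ℂ) ^ j‖ ≤ (M + S) * |ω| ^ n := by
    refine (norm_sub_le _ _).trans ?_
    rw [add_mul]
    refine add_le_add ((h ω).trans (le_mul_of_one_le_right hM.le (one_le_pow₀ hω))) ?_
    refine (norm_sum_le _ _).trans ?_
    rw [hS, Finset.sum_mul]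
    refine Finset.sum_le_sum fun j hj => ?_
    rw [norm_mul, norm_pow, Complex.norm_real, Real.norm_eq_abs]
    gcongr
    exact Nat.lt_succ_iff.1 (Finset.mem_range.1 hj)
  have hden := norm_symbolRatio_le a b γ 0 ω
  rw [symbolRatio, pow_zero, Nat.cast_zero, zero_sub, hk] at hden
  rw [adjSymbol, div_eq_mul_one_div, norm_mul]
  refine (mul_le_mul hnum hden (norm_nonneg _) (by positivity)).trans ?_
  rw [Real.rpow_neg hω0.le, Real.rpow_natCast]
  have e : (M + S) * |ω| ^ n * ((‖1 / b‖ + ‖1 / a‖) * (|ω| ^ (n + 1))⁻¹) =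
      (M + S) * (‖1 / b‖ + ‖1 / a‖) / |ω| := by
    field_simp
    ring
  rw [e]
  gcongr
  linarith

theorem integral_adjSymbol_dilate (hk : γ.re = ((n + 1 : ℕ) : ℝ)) (φ ψ θ : SchwartzMap ℝ ℂ)
    (hθ : schwartzFourierInv ψ = θ) {R : ℝ} (hR : 0 < R) :
    (R : ℂ) * ∫ u, adjSymbol a b γ (n + 1) φ (R * u) * θ u =
      ∫ x, integratorFun a b γ n φ (R⁻¹ * x) * ψ x := by
  have hR0 : (R : ℂ) ≠ 0 := by exact_mod_cast hR.ne'
  let ψR : SchwartzMap ℝ ℂ := SchwartzMap.compCLMOfContinuousLinearEquiv ℂ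
    (ContinuousLinearEquiv.smulLeft (R₁ := ℝ) (M₁ := ℝ) (Units.mk0 R hR.ne')) ψ
  have hψR : ∀ x, ψR x = ψ (R * x) := fun x => rfl
  have hinv : ∀ ω, fourierInv ψR ω = (R : ℂ)⁻¹ * θ (R⁻¹ * ω) := fun ω => by
    rw [← hθ, schwartzFourierInv_apply, fourierInv, fourierInv, mul_left_comm]
    congr 1
    have h := Measure.integral_comp_mul_left (fun u : ℝ => ψ u *
      Complex.exp (Complex.I * u * (R⁻¹ * ω : ℝ))) R
    rw [abs_of_pos (inv_pos.2 hR), Complex.real_smul, Complex.ofReal_inv] at h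
    rw [← h]
    refine integral_congr_ae (Eventually.of_forall fun x => ?_)
    simp only [hψR]
    congr 2
    push_cast
    field_simp
  obtain ⟨-, h⟩ := representedAt_of_lt_one a b (n := n) (by rw [hk]; simp) (by rw [hk]; simp) φ ψR
  rw [adjIntegrator] at h
  simp_rw [hinv, hψR] at h
  have h1 := Measure.integral_comp_mul_left
    (fun ω : ℝ => adjSymbol a b γ (n + 1) φ ω * ((R : ℂ)⁻¹ * θ (R⁻¹ * ω))) R
  have h2 := Measure.integral_comp_mul_left
    (fun x : ℝ => integratorFun a b γ n φ x * ψ (R * x)) R⁻¹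
  rw [abs_of_pos (inv_pos.2 hR), Complex.real_smul] at h1
  rw [inv_inv, abs_of_pos hR, Complex.real_smul] at h2
  simp_rw [inv_mul_cancel_left₀ hR.ne'] at h1
  simp_rw [mul_inv_cancel_left₀ hR.ne'] at h2
  rw [h2, ← h]
  simp_rw [mul_left_comm _ ((R : ℂ)⁻¹)] at h1
  simp_rw [mul_left_comm _ ((R : ℂ)⁻¹), integral_const_mul] at h1 ⊢
  rw [Complex.ofReal_inv] at h1
  exact congrArg _ (mul_left_cancel₀ (inv_ne_zero hR0) h1)

theorem integral_schwartz_eq_zero (ψ θ : SchwartzMap ℝ ℂ) (hθ : schwartzFourierInv ψ = θ)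
    (h0 : θ 0 = 0) : ∫ x, ψ x = 0 := by
  rw [← hθ, schwartzFourierInv_apply, fourierInv] at h0
  have hpi : (Real.pi : ℂ) ≠ 0 := by exact_mod_cast Real.pi_ne_zero
  simpa [hpi] using h0

/-- A limit at `0` together with the decay `C/|x|` makes `g` bounded off `0`, so dominated
convergence applies to its dilates. -/
theorem tendsto_integral_dilate (hk : γ.re = ((n + 1 : ℕ) : ℝ)) (φ ψ : SchwartzMap ℝ ℂ) {l : ℂ}
    (hl : Tendsto (integratorFun a b γ n φ) (𝓝[≠] 0) (𝓝 l)) :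
    Tendsto (fun R : ℝ => ∫ x, integratorFun a b γ n φ (R⁻¹ * x) * ψ x) atTop
      (𝓝 (∫ x, l * ψ x)) := by
  set g := integratorFun a b γ n φ with hg
  have hk' : -1 < ((n + 1 : ℕ) : ℝ) - γ.re := by rw [hk]; simp
  have hgm := aestronglyMeasurable_of_continuousOn_compl_zero (continuousOn_integratorFun a b hk' φ)
  have hbd : ∃ M, 0 ≤ M ∧ ∀ x : ℝ, x ≠ 0 → ‖g x‖ ≤ M := by
    obtain ⟨C, hC, h⟩ := norm_integratorFun_le_rpow a b hk' φ
    have hexp : -(((n + 1 : ℕ) : ℝ) + 1 - γ.re) = -1 := by rw [hk]; ring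
    simp_rw [hexp, Real.rpow_neg_one] at h
    have hev : ∀ᶠ x in 𝓝[≠] (0 : ℝ), ‖g x‖ < ‖l‖ + 1 :=
      hl.norm.eventually (gt_mem_nhds (by linarith))
    rw [eventually_nhdsWithin_iff] at hev
    obtain ⟨δ, hδ, hball⟩ := Metric.eventually_nhds_iff.1 hev
    refine ⟨‖l‖ + 1 + C * δ⁻¹, by positivity, fun x hx => ?_⟩
    have h1 : 0 ≤ C * δ⁻¹ := by positivity
    rcases lt_or_ge |x| δ with hxδ | hxδ
    · have := hball (by simpa using hxδ) hx
      linarith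
    · have h2 : C * |x|⁻¹ ≤ C * δ⁻¹ := by gcongr
      linarith [h x hx, norm_nonneg l]
  obtain ⟨M, hM, hgM⟩ := hbd
  refine tendsto_integral_filter_of_dominated_convergence (fun x => M * ‖ψ x‖) ?_ ?_
    (ψ.integrable.norm.const_mul M) ?_
  · filter_upwards [eventually_gt_atTop (0 : ℝ)] with R hR
    refine AEStronglyMeasurable.mul ?_ ψ.continuous.aestronglyMeasurable
    exact hgm.comp_quasiMeasurePreserving (Measure.quasiMeasurePreserving_smul volume
      (inv_pos.2 hR).ne')
  · filter_upwards [eventually_gt_atTop (0 : ℝ)] with R hR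
    filter_upwards [Measure.ae_ne volume (0 : ℝ)] with x hx
    rw [norm_mul]
    gcongr
    exact hgM _ (mul_ne_zero (inv_pos.2 hR).ne' hx)
  · filter_upwards [Measure.ae_ne volume (0 : ℝ)] with x hx
    refine (hl.comp (tendsto_nhdsWithin_iff.2 ⟨?_, ?_⟩)).mul_const _
    · simpa using (tendsto_inv_atTop_zero (𝕜 := ℝ)).mul_const x
    · filter_upwards [eventually_gt_atTop (0 : ℝ)] with R hR
      exact mul_ne_zero (inv_pos.2 hR).ne' hx

/-- The scaled pairing has two limits: `0` on the space side, and a non-zero multiple of this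
integral on the frequency side. Vanishing of `θ` below `1` serves twice: `θ(0) = 0` gives `ψ` zero
mean, and `Ru ≥ 1` on the relevant set makes the bound `C/|ω|` available. -/
theorem integral_symbolRatio_mul_eq_zero (hk : γ.re = ((n + 1 : ℕ) : ℝ)) (φ θ : SchwartzMap ℝ ℂ)
    (hφ : iteratedDeriv n (fourier φ) 0 ≠ 0) (hθ : ∀ u < 1, θ u = 0) {l : ℂ}
    (hl : Tendsto (integratorFun a b γ n φ) (𝓝[≠] 0) (𝓝 l)) :
    ∫ u, symbolRatio a b γ n u * θ u = 0 := by
  obtain ⟨ψ, hψ⟩ := exists_schwartzFourierInv_eq θ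
  obtain ⟨C, hC, hbound⟩ := exists_norm_adjSymbol_le_div a b hk φ
  have hzero : Tendsto (fun R : ℝ => (R : ℂ) ^ (γ - n - 1) *
      ((R : ℂ) * ∫ u, adjSymbol a b γ (n + 1) φ (R * u) * θ u)) atTop (𝓝 0) := by
    have h := tendsto_integral_dilate a b hk φ ψ hl
    rw [integral_const_mul, integral_schwartz_eq_zero ψ θ hψ (hθ 0 one_pos), mul_zero] at h
    refine squeeze_zero_norm' ?_ (tendsto_zero_iff_norm_tendsto_zero.1 h)
    filter_upwards [eventually_gt_atTop (0 : ℝ)] with R hR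
    rw [integral_adjSymbol_dilate a b hk φ ψ θ hψ hR, norm_mul,
      Complex.norm_cpow_eq_rpow_re_of_pos hR]
    -- The power `R^(γ-n-1)` may oscillate but has modulus one, so it cannot spoil a limit equal to
    -- zero.
    have : (γ - n - 1).re = 0 := by simp [hk]
    rw [this, Real.rpow_zero, one_mul]
  have hlim : Tendsto (fun R : ℝ => ∫ u, (R : ℂ) ^ (γ - n) *
      adjSymbol a b γ (n + 1) φ (R * u) * θ u) atTop
      (𝓝 (∫ u, -(iteratedDeriv n (fourier φ) 0 / (n.factorial : ℂ)) *
        symbolRatio a b γ n u * θ u)) := by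
    refine tendsto_integral_filter_of_dominated_convergence (fun u => C * ‖θ u‖) ?_ ?_
      (θ.integrable.norm.const_mul C) ?_
    · refine Eventually.of_forall fun R => AEStronglyMeasurable.mul ?_
        θ.continuous.aestronglyMeasurable
      exact (((measurable_adjSymbol a b γ (n + 1) φ).comp
        (measurable_const_mul R)).const_mul _).aestronglyMeasurable
    · filter_upwards [eventually_ge_atTop (1 : ℝ)] with R hR
      refine Eventually.of_forall fun u => ?_
      rcases lt_or_ge u 1 with hu | hu
      · simp [hθ u hu]
      · have hR0 : 0 < R := by linarith
        have hRu : 1 ≤ R * u := by nlinarith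
        have hb := hbound (R * u) (by rwa [abs_of_pos (by linarith)])
        have hre : (γ - n).re = 1 := by simp [hk]
        rw [abs_of_pos (by linarith), le_div_iff₀ (by linarith)] at hb
        rw [norm_mul, norm_mul, Complex.norm_cpow_eq_rpow_re_of_pos hR0, hre, Real.rpow_one]
        gcongr
        nlinarith [norm_nonneg (adjSymbol a b γ (n + 1) φ (R * u)),
          mul_nonneg hR0.le (norm_nonneg (adjSymbol a b γ (n + 1) φ (R * u)))]
    · refine (Measure.ae_ne volume (0 : ℝ)).mono fun u hu => ?_
      exact (tendsto_rpow_mul_adjSymbol a b φ hu).mul_const _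
  have heq : (fun R : ℝ => ∫ u, (R : ℂ) ^ (γ - n) * adjSymbol a b γ (n + 1) φ (R * u) * θ u)
      =ᶠ[atTop] fun R : ℝ => (R : ℂ) ^ (γ - n - 1) *
        ((R : ℂ) * ∫ u, adjSymbol a b γ (n + 1) φ (R * u) * θ u) := by
    filter_upwards [eventually_gt_atTop (0 : ℝ)] with R hR
    have hR0 : (R : ℂ) ≠ 0 := by exact_mod_cast hR.ne'
    simp_rw [mul_assoc, integral_const_mul]
    rw [Complex.cpow_sub (γ - n) 1 hR0, Complex.cpow_one, ← mul_assoc, div_mul_cancel₀ _ hR0]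
  have h0 := tendsto_nhds_unique (hlim.congr' heq) hzero
  simp_rw [mul_assoc] at h0
  rw [integral_const_mul, mul_eq_zero] at h0
  refine h0.resolve_left (neg_ne_zero.2 (div_ne_zero hφ ?_))
  exact_mod_cast n.factorial_ne_zero

/-- Were there a limit, `u^n/h(-u)` would annihilate all test functions on `(1, ∞)` and so vanish
almost everywhere there, although it is a non-zero multiple of a power. -/
theorem singularAtZero_integratorFun (hb : b ≠ 0) (hk : γ.re = ((n + 1 : ℕ) : ℝ))
    (φ : SchwartzMap ℝ ℂ) (hφ : iteratedDeriv n (fourier φ) 0 ≠ 0) :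
    SingularAtZero (integratorFun a b γ n φ) := by
  rintro ⟨l, hl⟩
  have hcont : ContinuousOn (symbolRatio a b γ n) (Ioi 1) := by
    have h : ContinuousOn (fun ω : ℝ => 1 / b * (ω : ℂ) ^ ((n : ℂ) - γ)) (Ioi 1) := fun ω hω =>
      (continuousAt_const.mul (ContinuousAt.cpow (by fun_prop) continuousAt_const
        (Complex.ofReal_mem_slitPlane.2 (one_pos.trans hω)))).continuousWithinAt
    exact h.congr fun ω hω => symbolRatio_of_pos a b γ n (one_pos.trans hω)
  have hae := isOpen_Ioi.ae_eq_zero_of_integral_contDiff_smul_eq_zero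
    (hcont.locallyIntegrableOn (μ := volume) measurableSet_Ioi) fun ρ hρ hρc hρs => by
      have h1 : HasCompactSupport fun x => (ρ x : ℂ) := hρc.comp_left Complex.ofReal_zero
      have h2 : ContDiff ℝ (⊤ : ℕ∞) fun x => (ρ x : ℂ) := Complex.ofRealCLM.contDiff.comp hρ
      have h := integral_symbolRatio_mul_eq_zero a b hk φ (h1.toSchwartzMap h2) hφ (fun u hu => by
        have : ρ u = 0 := image_eq_zero_of_notMem_tsupport fun hm => (hρs hm).not_gt hu
        simp [this]) hl
      rw [← h]
      refine integral_congr_ae (Eventually.of_forall fun u => ?_)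
      simp [mul_comm]
  have hne : ∀ᵐ x : ℝ, x ∉ Ioi (1 : ℝ) := hae.mono fun x hx hx1 => by
    have hx0 : (0 : ℝ) < x := one_pos.trans hx1
    have h := hx hx1
    rw [symbolRatio_of_pos _ _ _ _ hx0] at h
    have hx0' : (x : ℂ) ≠ 0 := by exact_mod_cast hx0.ne'
    simp [hb, Complex.cpow_eq_zero_iff, hx0'] at h
  have hv : volume (Ioi (1 : ℝ)) = 0 := measure_eq_zero_iff_ae_notMem.2 hne
  simp at hv

end Singular

end FracInt

end

/-! ### The theorem, case by case -/

theorem mainTheorem3 (a b γ : ℂ) (ha : a ≠ 0) (hb : b ≠ 0) (hγ : 0 < γ.re)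
    (k : ℕ) (hk : max 1 ⌊γ.re⌋₊ ≤ k) (φ : SchwartzMap ℝ ℂ) :
    -- the output is a well-defined tempered distribution
    (∀ ψ : SchwartzMap ℝ ℂ,
      Integrable (fun ω : ℝ => FracInt.adjSymbol a b γ k φ ω * FracInt.fourierInv ψ ω)) ∧
    (∃ T : TemperedDistribution ℝ ℂ,
      ∀ ψ : SchwartzMap ℝ ℂ, T ψ = FracInt.adjIntegrator a b γ k φ ψ) ∧
    -- it is a function `g`, continuous away from `0`
    ∃ g : ℝ → ℂ, ContinuousOn g {0}ᶜ ∧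
      (∀ ψ : SchwartzMap ℝ ℂ, (0 : ℝ) ∉ tsupport ψ →
        FracInt.RepresentedAt (FracInt.adjIntegrator a b γ k φ) g ψ) ∧
      ((k : ℝ) - γ.re < 1 → ∀ ψ : SchwartzMap ℝ ℂ,
        FracInt.RepresentedAt (FracInt.adjIntegrator a b γ k φ) g ψ) ∧
      -- (i)
      ((¬ ∃ n : ℕ, γ.re = n) → k = ⌊γ.re⌋₊ →
        FracInt.BoundedNearZero (fun x => ‖g x‖) ∧
        (∀ p : ℝ, 1 / ((k : ℝ) + 1 - γ.re) < p → MemLp g (ENNReal.ofReal p) volume) ∧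
        ∃ c : ℝ, 0 < c ∧ ∀ x : ℝ, 1 ≤ |x| →
          ‖g x‖ ≤ c / |x| ^ ((k : ℝ) + 1 - γ.re)) ∧
      -- (ii)
      (FracInt.IsPureInteger a b γ → k = ⌊γ.re⌋₊ →
        FracInt.BoundedNearZero (fun x => ‖g x‖) ∧
        ∀ p : ℝ, 0 < p → MemLp g (ENNReal.ofReal p) volume) ∧
      -- (iii)
      ((∃ n : ℕ, γ.re = n) → ¬ FracInt.IsPureInteger a b γ → k = ⌊γ.re⌋₊ →
        (iteratedDeriv (k - 1) (FracInt.fourier φ) 0 ≠ 0 →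
          FracInt.SingularAtZero g ∧
          ((∃ n : ℕ, γ = n) → Tendsto (fun x => ‖g x‖) (𝓝[≠] (0 : ℝ)) atTop)) ∧
        FracInt.BoundedNearZero (fun x => ‖g x‖ / Real.log |x|) ∧
        (∀ p : ℝ, 1 < p → MemLp g (ENNReal.ofReal p) volume) ∧
        ∃ c : ℝ, 0 < c ∧ ∀ x : ℝ, 1 ≤ |x| →
          ‖g x‖ ≤ c * ((1 + Real.log |x|) / |x|)) ∧
      -- (iv)
      ((¬ ∃ n : ℕ, γ.re = n) → ⌊γ.re⌋₊ < k →
        FracInt.BoundedNearZero (fun x => |x| ^ ((k : ℝ) - γ.re) * ‖g x‖) ∧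
        (∀ p : ℝ, 1 / ((k : ℝ) + 1 - γ.re) < p → p < 1 / ((k : ℝ) - γ.re) →
          MemLp g (ENNReal.ofReal p) volume) ∧
        ∃ c : ℝ, 0 < c ∧ ∀ x : ℝ, 1 ≤ |x| →
          ‖g x‖ ≤ c / |x| ^ ((k : ℝ) + 1 - γ.re)) ∧
      -- (v)
      ((∃ n : ℕ, γ.re = n) → ⌊γ.re⌋₊ < k →
        FracInt.BoundedNearZero (fun x => |x| ^ ((k : ℝ) - γ.re) * ‖g x‖) ∧
        (∀ p : ℝ, 1 / ((k : ℝ) + 1 - γ.re) < p → p < 1 / ((k : ℝ) - γ.re) →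
          MemLp g (ENNReal.ofReal p) volume) ∧
        ∃ c : ℝ, 0 < c ∧ ∀ x : ℝ, 1 ≤ |x| →
          ‖g x‖ ≤ c * ((1 + Real.log |x|) / |x| ^ ((k : ℝ) + 1 - γ.re))) := by
  obtain ⟨n, rfl⟩ : ∃ n, k = n + 1 :=
    ⟨k - 1, (Nat.sub_add_cancel ((le_max_left _ _).trans hk)).symm⟩
  have hfl : ⌊γ.re⌋₊ ≤ n + 1 := (le_max_right _ _).trans hk
  have hk1 : -1 < ((n + 1 : ℕ) : ℝ) - γ.re := by
    have h1 := Nat.lt_floor_add_one γ.re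
    have h2 : (⌊γ.re⌋₊ : ℝ) ≤ ((n + 1 : ℕ) : ℝ) := by exact_mod_cast hfl
    linarith
  have hfloor : n + 1 = ⌊γ.re⌋₊ → (∃ m : ℕ, γ.re = m) → γ.re = ((n + 1 : ℕ) : ℝ) := by
    rintro h ⟨m, hm⟩
    rw [h, hm, Nat.floor_natCast]
  have hpos : ⌊γ.re⌋₊ < n + 1 → 0 < ((n + 1 : ℕ) : ℝ) - γ.re := fun h => by
    have h1 := (Nat.floor_lt hγ.le).1 h
    linarith
  refine ⟨fun ψ => ?_, FracInt.exists_temperedDistribution_adjIntegrator a b hk1 φ,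
    FracInt.integratorFun a b γ n φ, FracInt.continuousOn_integratorFun a b hk1 φ,
    fun ψ hψ => FracInt.representedAt_of_notMem_tsupport a b hk1 φ ψ hψ,
    fun h ψ => FracInt.representedAt_of_lt_one a b hk1 h φ ψ, ?_, ?_, ?_, ?_, ?_⟩
  · rw [← FracInt.coe_schwartzFourierInv]
    exact FracInt.integrable_adjSymbol_mul a b hk1 φ _
  · intro hnat hkf
    have hneg : ((n + 1 : ℕ) : ℝ) - γ.re < 0 := by
      have h1 : ((n + 1 : ℕ) : ℝ) ≤ γ.re := by rw [hkf]; exact Nat.floor_le hγ.le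
      have h2 : γ.re ≠ ((n + 1 : ℕ) : ℝ) := fun h => hnat ⟨_, h⟩
      linarith [lt_of_le_of_ne h1 h2.symm]
    refine ⟨FracInt.boundedNearZero_integratorFun_of_neg a b hk1 hneg φ, fun p hp => ?_,
      FracInt.exists_decay_integratorFun a b hk1 φ⟩
    exact FracInt.memLp_integratorFun a b hk1 φ hp (by simp)
      (FracInt.norm_integratorFun_le_of_sub_lt a b hk1 φ le_rfl (by linarith) hneg)
  · intro hpure hkf
    obtain ⟨m, rfl, -⟩ := id hpure
    obtain rfl : n + 1 = m := by rw [hkf, Complex.natCast_re, Nat.floor_natCast]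
    refine ⟨?_, fun p hp => FracInt.memLp_integratorFun_of_isPureInteger ha hb n φ hpure hp⟩
    obtain ⟨K, hK⟩ := FracInt.exists_norm_integratorFun_le_of_isPureInteger ha hb n φ hpure
    refine ⟨K, eventually_mem_nhdsWithin.mono fun x hx => ?_⟩
    rw [abs_norm]
    exact hK x hx
  · intro hnat hpure hkf
    have hre := hfloor hkf hnat
    refine ⟨fun hφ => ⟨FracInt.singularAtZero_integratorFun a b hb hre φ hφ, ?_⟩,
      FracInt.boundedNearZero_integratorFun_div_log a b (by rw [hre, sub_self]) φ,
      fun p hp => ?_, ?_⟩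
    · rintro ⟨m, rfl⟩
      obtain rfl : m = n + 1 := by exact_mod_cast hre
      exact FracInt.tendsto_norm_integratorFun_natCast ha hb n φ hpure hφ
    · have hp0 : 0 < p := by linarith
      have hs : ((n + 1 : ℕ) : ℝ) + 1 - γ.re = 1 := by rw [hre]; ring
      -- The logarithm at `0` is dominated by `|x|^(-u)` for any `u > 0`; this choice gives `u p =
      -- 1/2 < 1`.
      refine FracInt.memLp_integratorFun a b (u := 1 / (2 * p)) hk1 φ ?_ ?_
        (FracInt.norm_integratorFun_le_of_sub_lt a b hk1 φ (by positivity) ?_ ?_)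
      · rwa [hs, div_one]
      · field_simp
        norm_num
      · rw [hs, div_le_one (by positivity)]
        linarith
      · rw [hre, sub_self]
        positivity
    · have hs : ((n + 1 : ℕ) : ℝ) + 1 - γ.re = 1 := by rw [hre]; ring
      have h := FracInt.exists_log_decay_integratorFun a b hk1 φ
      simp_rw [hs, Real.rpow_one] at h
      exact h
  · intro _ hlt
    exact ⟨FracInt.boundedNearZero_rpow_mul_integratorFun a b (hpos hlt) φ,
      fun p hp hp' => FracInt.memLp_integratorFun_of_pos a b (hpos hlt) φ hp hp',
      FracInt.exists_decay_integratorFun a b hk1 φ⟩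
  · intro _ hlt
    exact ⟨FracInt.boundedNearZero_rpow_mul_integratorFun a b (hpos hlt) φ,
      fun p hp hp' => FracInt.memLp_integratorFun_of_pos a b (hpos hlt) φ hp hp',
      FracInt.exists_log_decay_integratorFun a b hk1 φ⟩
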